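/- **Theorem (convergence rate of the PD3O algorithm).** Let $\mathcal{X}$ and $\mathcal{U}$ be finite-dimensional real Hilbert spaces, $K:\mathcal{X}\to\mathcal{U}$ a linear operator with adjoint $K^*$, $R:\mathcal{X}\to\mathbb{R}\cup\{+\infty\}$ and $H:\mathcal{U}\to\mathbb{R}\cup\{+\infty\}$ proper, closed, convex functions, and $F:\mathcal{X}\to\mathbb{R}$ a convex, differentiable function whose gradient is $L_F$-Lipschitz continuous, for some $L_F>0$. Suppose that there exists $x_0\in\mathcal{X}$ such that $0\in\nabla F(x_0)+\partial R(x_0)+K^*\partial H(Kx_0)$. Consider the primal problem of minimizing $$\Psi(x)=F(x)+R(x)+H(Kx)$$ over $x\in\mathcal{X}$, and the dual problem of minimizing $(F+R)^*(-K^*u)+H^*(u)$ over $u\in\mathcal{U}$, where $G^*$ denotes the convex conjugate of $G$. For a function $G$, denote by $\mathrm{prox}_{G}(z)$ the minimizer of $y\mapsto G(y)+\frac12\|y-z\|^2$. Let $\gamma\in(0,2/L_F)$ and $\eta>0$ with $\eta\geq\|K\|^2$. Let $q^0\in\mathcal{X}$ and $u^0\in\mathcal{U}$ be arbitrary and, for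 $k=0,1,\ldots$, let $$\begin{aligned} x^{k+1}&=\mathrm{prox}_{\gamma R}\big(\gamma(q^k-K^*u^k)\big),\\ q^{k+1}&=\tfrac1\gamma x^{k+1}-\nabla F(x^{k+1}),\\ u^{k+1}&=\mathrm{prox}_{H^*/(\gamma\eta)}\Big(u^k+\tfrac1\eta K\big(\tfrac1\gamma x^{k+1}+q^{k+1}-q^k\big)\Big). \end{aligned}$$ Then $x^k$ converges to some solution $x^\star$ of the primal problem and $u^k$ converges to some solution $u^\star$ of the dual problem. If, in addition, $H$ is continuous on an open ball centered at $Kx^\star$, then, as $k\to+\infty$, (i) $\Psi(x^k)-\Psi(x^\star)=o(1/\sqrt{k})$; (ii) $\Psi(\bar x^k)-\Psi(x^\star)=O(1/k)$, where $\bar x^k=\frac{2}{k(k+1)}\sum_{i=1}^k i\,x^i$ for $k\geq1$. If, furthermore, $H$ is $L$-smooth for some $L>0$ (that is, real-valued and differentiable with $L$-Lipschitz continuous gradient), then (iii) $\min_{i=1,\ldots,k}\Psi(x^i)-\Psi(x^\star)=o(1/k)$. In (i) and (ii), $\Psi(x^k)$ and $\Psi(\bar x^k)$ are finite for all $k$ large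 enough, and the rates are understood asymptotically. -/

import Mathlib

open Filter Topology Asymptotics

noncomputable section

/-- A function with values in `ℝ ∪ {+∞}` that is proper, closed (lower semicontinuous) and convex. -/
structure ProperClosedConvex {E : Type*} [NormedAddCommGroup E] [InnerProductSpace ℝ E]
    (G : E → EReal) : Prop where
  ne_bot : ∀ x, G x ≠ ⊥
  exists_ne_top : ∃ x, G x ≠ ⊤
  lsc : LowerSemicontinuous G
  convex : ∀ x y : E, ∀ a b : ℝ, 0 < a → 0 < b → a + b = 1 →
    G (a • x + b • y) ≤ (a : EReal) * G x + (b : EReal) * G y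

/-- `f` is `L`-smooth: differentiable with `L`-Lipschitz continuous gradient. -/
structure IsLSmooth {E : Type*} [NormedAddCommGroup E] [InnerProductSpace ℝ E] [CompleteSpace E]
    (L : ℝ) (f : E → ℝ) : Prop where
  differentiable : Differentiable ℝ f
  lipschitz : ∀ x y : E, ‖gradient f x - gradient f y‖ ≤ L * ‖x - y‖

/-- The subdifferential `∂G(x)`. -/
def subdiff {E : Type*} [NormedAddCommGroup E] [InnerProductSpace ℝ E]
    (G : E → EReal) (x : E) : Set E :=
  {v | ∀ y, G x + ((inner ℝ v (y - x) : ℝ) : EReal) ≤ G y}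

/-- The convex conjugate `G*(u) = sup_x ⟪u, x⟫ - G(x)`. -/
def conjugate {E : Type*} [NormedAddCommGroup E] [InnerProductSpace ℝ E]
    (G : E → EReal) (u : E) : EReal :=
  ⨆ x, ((inner ℝ u x : ℝ) : EReal) - G x

/-- `p = prox_{τ G}(z)`, that is, `p` minimizes `y ↦ τ G(y) + ‖y - z‖² / 2`. -/
def IsProx {E : Type*} [NormedAddCommGroup E] [InnerProductSpace ℝ E]
    (τ : ℝ) (G : E → EReal) (z p : E) : Prop :=
  ∀ y, (τ : EReal) * G p + ((‖p - z‖ ^ 2 / 2 : ℝ) : EReal) ≤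
    (τ : EReal) * G y + ((‖y - z‖ ^ 2 / 2 : ℝ) : EReal)

/-- `x` is a solution of the problem of minimizing `f`: a global minimizer with finite value. -/
def IsSolution {E : Type*} (f : E → EReal) (x : E) : Prop :=
  (∃ r : ℝ, f x = (r : EReal)) ∧ ∀ y, f x ≤ f y

/-- The primal objective `Ψ(x) = F(x) + R(x) + H(K x)`. -/
def primalObj {X U : Type*} [NormedAddCommGroup X] [InnerProductSpace ℝ X]
    [NormedAddCommGroup U] [InnerProductSpace ℝ U]
    (F : X → ℝ) (R : X → EReal) (H : U → EReal) (K : X →L[ℝ] U) (x : X) : EReal :=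
  (F x : EReal) + R x + H (K x)

/-- The dual objective `(F + R)*(-K* u) + H*(u)`. -/
def dualObj {X U : Type*} [NormedAddCommGroup X] [InnerProductSpace ℝ X] [CompleteSpace X]
    [NormedAddCommGroup U] [InnerProductSpace ℝ U] [CompleteSpace U]
    (F : X → ℝ) (R : X → EReal) (H : U → EReal) (K : X →L[ℝ] U) (u : U) : EReal :=
  conjugate (fun x => (F x : EReal) + R x) (-(ContinuousLinearMap.adjoint K u)) + conjugate H u

/-- The sequences `x, q, u` are generated by the PD3O algorithm with stepsizes `γ k` and
parameter `η`, from arbitrary initial points `q 0` and `u 0`. The iterates of `x` are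
`x 1, x 2, …`; the value `x 0` is not part of the algorithm. -/
structure IsPD3O {X U : Type*} [NormedAddCommGroup X] [InnerProductSpace ℝ X] [CompleteSpace X]
    [NormedAddCommGroup U] [InnerProductSpace ℝ U] [CompleteSpace U]
    (F : X → ℝ) (R : X → EReal) (H : U → EReal) (K : X →L[ℝ] U) (γ : ℕ → ℝ) (η : ℝ)
    (x q : ℕ → X) (u : ℕ → U) : Prop where
  x_step : ∀ k, IsProx (γ k) R (γ k • (q k - ContinuousLinearMap.adjoint K (u k))) (x (k + 1))
  q_step : ∀ k, q (k + 1) = (1 / γ (k + 1)) • x (k + 1) - gradient F (x (k + 1))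
  u_step : ∀ k, IsProx (1 / (γ (k + 1) * η)) (conjugate H)
    (u k + (1 / η) • K ((1 / γ k) • x (k + 1) + q (k + 1) - q k)) (u (k + 1))

/-- The weighted ergodic iterate `2 / (k (k + 1)) ∑_{i=1}^k i x^i`, for `k ≥ 1`. -/
def ergodicIterate {X : Type*} [NormedAddCommGroup X] [InnerProductSpace ℝ X]
    (x : ℕ → X) (k : ℕ) : X :=
  (2 / ((k : ℝ) * ((k : ℝ) + 1))) • ∑ i ∈ Finset.Icc 1 k, (i : ℝ) • x i

end

/-! ### Subgradients, proximal points and conjugates of extended-valued convex functions -/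

section ConvexAnalysis

variable {E : Type*} [NormedAddCommGroup E] [InnerProductSpace ℝ E]

/-! Put s = q - K*u. An iteration maps (s, u) to (s', u') through s - x/γ ∈ ∂R(x), u' ∈ ∂H(y) and s'
= x/γ - ∇F(x) - K*u', where y - Kx is a linear image of the increment (s' - s, u' - u). Distances
are measured by Q(s, u) = ‖s‖² + η‖u‖² - ‖K*u‖², nonnegative because η ≥ ‖K‖². A linear identity
(`pd3oForm_step_eq`), applied to the difference of two steps, shows that Q drops by Q of the
difference of the increments and by 2/γ times the monotonicity products of ∇F, ∂R and ∂H, up to a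
cross term between increments and gradients. Cocoercivity of ∇F absorbs the cross term because γ <
2/L_F (`PD3OStep.pd3oForm_add_le`).

A saddle point is a fixed point of the step. Comparison with it makes the distance (`excess`)
nonincreasing and makes the squared increments, the squared gradient errors and the dual products
summable. Comparison of consecutive steps makes the increments nonincreasing. Boundedness and
closedness of the subdifferentials give a cluster point that is a saddle point; the distance to it
is monotone and vanishes along a subsequence, so everything converges
(`PD3OSequence.exists_tendsto`).

For the rates, convexity bounds F(x) + R(x) + H(y) - Ψ(x*) by the three products plus ⟨u*, y - Kx⟩
(`value_sub_le`). (i) This bound is linear in the increment, whose square is monotone and summable,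
hence o(1/k); local Lipschitz continuity of H replaces y by Kx. (ii) With weights proportional to i,
Abel summation bounds the weighted sum by O(k), against a total weight of order k². (iii) When H is
smooth, the error of replacing y by Kx is quadratic, so the objective gaps are summable; their
running minimum is monotone, hence o(1/k). -/

theorem EReal.exists_coe_eq {a : EReal} (h : a ≠ ⊤) (h' : a ≠ ⊥) : ∃ r : ℝ, a = r :=
  ⟨a.toReal, (EReal.coe_toReal h h').symm⟩

theorem nonneg_of_forall_nonneg_add_mul {c C : ℝ} (h : ∀ t : ℝ, 0 < t → t < 1 → 0 ≤ c + t * C) :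
    0 ≤ c := by
  have h1 : Tendsto (fun t : ℝ => c + t * C) (𝓝[>] 0) (𝓝 (c + 0 * C)) :=
    (Continuous.tendsto (by fun_prop) 0).mono_left nhdsWithin_le_nhds
  rw [zero_mul, add_zero] at h1
  refine ge_of_tendsto h1 ?_
  filter_upwards [Ioo_mem_nhdsGT (zero_lt_one' ℝ)] with t ht using h t ht.1 ht.2

namespace ProperClosedConvex

variable {G : E → EReal}

theorem ne_top_of_mem_subdiff (hG : ProperClosedConvex G) {x v : E} (hv : v ∈ subdiff G x) :
    G x ≠ ⊤ := by
  obtain ⟨y, hy⟩ := hG.exists_ne_top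
  intro h
  have := hv y
  rw [h, EReal.top_add_coe, top_le_iff] at this
  exact hy this

theorem exists_coe_of_mem_subdiff (hG : ProperClosedConvex G) {x v : E} (hv : v ∈ subdiff G x) :
    ∃ r : ℝ, G x = r :=
  EReal.exists_coe_eq (hG.ne_top_of_mem_subdiff hv) (hG.ne_bot x)

theorem toReal_sub_le (hG : ProperClosedConvex G) {x y v : E} (hv : v ∈ subdiff G x)
    (hy : G y ≠ ⊤) : (G x).toReal - (G y).toReal ≤ inner ℝ v (x - y) := by
  obtain ⟨a, ha⟩ := hG.exists_coe_of_mem_subdiff hv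
  obtain ⟨b, hb⟩ := EReal.exists_coe_eq hy (hG.ne_bot y)
  have := hv y
  rw [ha, hb, ← EReal.coe_add, EReal.coe_le_coe_iff] at this
  rw [ha, hb, EReal.toReal_coe, EReal.toReal_coe]
  rw [← neg_sub x y, inner_neg_right] at this
  linarith

theorem inner_subdiff_nonneg (hG : ProperClosedConvex G) {x y v w : E} (hv : v ∈ subdiff G x)
    (hw : w ∈ subdiff G y) : 0 ≤ (inner ℝ (v - w) (x - y) : ℝ) := by
  have h1 := hG.toReal_sub_le hv (hG.ne_top_of_mem_subdiff hw)
  have h2 := hG.toReal_sub_le hw (hG.ne_top_of_mem_subdiff hv)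
  rw [← neg_sub x y, inner_neg_right] at h2
  rw [inner_sub_left]
  linarith

/-- The subdifferential has closed graph: lower semicontinuity lets the subgradient inequality pass
to the limit. -/
theorem mem_subdiff_of_tendsto (hG : ProperClosedConvex G) {x v : ℕ → E} {x' v' : E}
    (h : ∀ n, v n ∈ subdiff G (x n)) (hx : Tendsto x atTop (𝓝 x')) (hv : Tendsto v atTop (𝓝 v')) :
    v' ∈ subdiff G x' := by
  intro y
  by_cases hy : G y = ⊤
  · rw [hy]; exact le_top
  obtain ⟨b, hb⟩ := EReal.exists_coe_eq hy (hG.ne_bot y)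
  have key : G x' ≤ ((b - inner ℝ v' (y - x') : ℝ) : EReal) := by
    by_contra! hlt
    obtain ⟨c, hc1, hc2⟩ := EReal.lt_iff_exists_real_btwn.1 hlt
    have e1 := hx.eventually (hG.lsc x' _ hc2)
    have h3 : Tendsto (fun n => b - inner ℝ (v n) (y - x n)) atTop
        (𝓝 (b - inner ℝ v' (y - x'))) :=
      tendsto_const_nhds.sub (hv.inner (tendsto_const_nhds.sub hx))
    have e2 := h3.eventually_lt_const (EReal.coe_lt_coe_iff.1 hc1)
    obtain ⟨n, hn1, hn2⟩ := (e1.and e2).exists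
    obtain ⟨a, ha⟩ := hG.exists_coe_of_mem_subdiff (h n)
    have h4 := h n y
    rw [ha, hb, ← EReal.coe_add, EReal.coe_le_coe_iff] at h4
    rw [ha, gt_iff_lt, EReal.coe_lt_coe_iff] at hn1
    linarith
  calc G x' + ((inner ℝ v' (y - x') : ℝ) : EReal)
      ≤ ((b - inner ℝ v' (y - x') : ℝ) : EReal) + ((inner ℝ v' (y - x') : ℝ) : EReal) := by gcongr
    _ = G y := by rw [hb, ← EReal.coe_add, sub_add_cancel]

theorem convexOn_toReal (hG : ProperClosedConvex G) :
    ConvexOn ℝ {x | G x ≠ ⊤} (fun x => (G x).toReal) := by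
  have key : ∀ x, G x ≠ ⊤ → ∀ y, G y ≠ ⊤ → ∀ a b : ℝ, 0 < a → 0 < b → a + b = 1 →
      G (a • x + b • y) ≤ ((a * (G x).toReal + b * (G y).toReal : ℝ) : EReal) := by
    intro x hx y hy a b ha hb hab
    obtain ⟨c, hc⟩ := EReal.exists_coe_eq hx (hG.ne_bot x)
    obtain ⟨d, hd⟩ := EReal.exists_coe_eq hy (hG.ne_bot y)
    have := hG.convex x y a b ha hb hab
    rw [hc, hd] at this ⊢
    exact_mod_cast this
  refine convexOn_iff_forall_pos.2 ⟨convex_iff_forall_pos.2 fun x hx y hy a b ha hb hab => ?_,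
    fun x hx y hy a b ha hb hab => ?_⟩
  · exact ne_top_of_le_ne_top (EReal.coe_ne_top _) (key x hx y hy a b ha hb hab)
  · have := EReal.toReal_le_toReal (key x hx y hy a b ha hb hab) (hG.ne_bot _) (EReal.coe_ne_top _)
    rwa [EReal.toReal_coe] at this

/-- First-order optimality: compare p with (1 - t)p + ty, use convexity of G, divide by t and let t
tend to 0. -/
theorem smul_sub_mem_subdiff (hG : ProperClosedConvex G) {τ : ℝ} {z p : E}
    (hp : ∀ y, G p + ((τ / 2 * ‖p - z‖ ^ 2 : ℝ) : EReal) ≤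
      G y + ((τ / 2 * ‖y - z‖ ^ 2 : ℝ) : EReal)) : τ • (z - p) ∈ subdiff G p := by
  have hptop : G p ≠ ⊤ := by
    obtain ⟨y, hy⟩ := hG.exists_ne_top
    obtain ⟨b, hb⟩ := EReal.exists_coe_eq hy (hG.ne_bot y)
    intro h
    have := hp y
    rw [h, EReal.top_add_coe, top_le_iff, hb, ← EReal.coe_add] at this
    exact EReal.coe_ne_top _ this
  obtain ⟨a, ha⟩ := EReal.exists_coe_eq hptop (hG.ne_bot p)
  intro y
  by_cases hy : G y = ⊤
  · rw [hy]; exact le_top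
  obtain ⟨b, hb⟩ := EReal.exists_coe_eq hy (hG.ne_bot y)
  rw [ha, hb, ← EReal.coe_add, EReal.coe_le_coe_iff]
  suffices 0 ≤ b - a + τ * inner ℝ (p - z) (y - p) by
    rw [real_inner_smul_left, ← neg_sub p z, inner_neg_left]
    linarith
  refine nonneg_of_forall_nonneg_add_mul (C := τ / 2 * ‖y - p‖ ^ 2) fun t ht0 ht1 => ?_
  have h1 := hG.convex p y (1 - t) t (by linarith) ht0 (by ring)
  have h2 := hp ((1 - t) • p + t • y)
  rw [ha, hb] at h1
  rw [ha] at h2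
  have h3 : ((a + τ / 2 * ‖p - z‖ ^ 2 : ℝ) : EReal) ≤
      (((1 - t) * a + t * b + τ / 2 * ‖(1 - t) • p + t • y - z‖ ^ 2 : ℝ) : EReal) := by
    rw [EReal.coe_add, EReal.coe_add, EReal.coe_add, EReal.coe_mul (1 - t), EReal.coe_mul t]
    exact h2.trans (add_le_add_left h1 _)
  rw [EReal.coe_le_coe_iff] at h3
  have h4 : (1 - t) • p + t • y - z = (p - z) + t • (y - p) := by module
  rw [h4, norm_add_sq_real, norm_smul, inner_smul_right, Real.norm_eq_abs, mul_pow, sq_abs] at h3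
  have h5 : 0 ≤ t * (b - a + τ * inner ℝ (p - z) (y - p) + t * (τ / 2 * ‖y - p‖ ^ 2)) := by
    linarith
  exact nonneg_of_mul_nonneg_right h5 ht0

theorem mem_subdiff_of_isProx (hG : ProperClosedConvex G) {τ : ℝ} (hτ : 0 < τ) {z p : E}
    (hp : IsProx τ G z p) : (1 / τ) • (z - p) ∈ subdiff G p := by
  refine hG.smul_sub_mem_subdiff fun y => ?_
  have hy := hp y
  by_cases hytop : G y = ⊤
  · rw [hytop, EReal.top_add_coe]; exact le_top
  obtain ⟨b, hb⟩ := EReal.exists_coe_eq hytop (hG.ne_bot y)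
  have hptop : G p ≠ ⊤ := by
    intro h
    rw [h, EReal.coe_mul_top_of_pos hτ, EReal.top_add_coe, top_le_iff, hb, ← EReal.coe_mul,
      ← EReal.coe_add] at hy
    exact EReal.coe_ne_top _ hy
  obtain ⟨a, ha⟩ := EReal.exists_coe_eq hptop (hG.ne_bot p)
  rw [ha, hb] at hy ⊢
  norm_cast at hy ⊢
  have h1 : (1 / τ) * (τ * a + ‖p - z‖ ^ 2 / 2) ≤ (1 / τ) * (τ * b + ‖y - z‖ ^ 2 / 2) := by
    gcongr
  have h2 : ∀ c d : ℝ, (1 / τ) * (τ * c + d / 2) = c + 1 / τ / 2 * d := by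
    intro c d; field_simp
  rwa [h2, h2] at h1

/-- A single subgradient gives an affine minorant, which the quadratic dominates at infinity; lower
semicontinuity on a compact ball then gives a minimizer. -/
theorem exists_forall_add_sq_le [FiniteDimensional ℝ E] (hG : ProperClosedConvex G) {x₀ v₀ : E}
    (hv : v₀ ∈ subdiff G x₀) {τ : ℝ} (hτ : 0 < τ) (z : E) :
    ∃ p, ∀ y, G p + ((τ / 2 * ‖p - z‖ ^ 2 : ℝ) : EReal) ≤
      G y + ((τ / 2 * ‖y - z‖ ^ 2 : ℝ) : EReal) := by
  have := FiniteDimensional.proper_real E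
  obtain ⟨a, ha⟩ := hG.exists_coe_of_mem_subdiff hv
  have hlsc : LowerSemicontinuous
      (fun y => G y + ((τ / 2 * ‖y - z‖ ^ 2 : ℝ) : EReal)) := by
    refine hG.lsc.add' (Continuous.lowerSemicontinuous ?_) fun y => ?_
    · exact continuous_coe_real_ereal.comp (by fun_prop)
    · exact EReal.continuousAt_add (Or.inr (EReal.coe_ne_bot _)) (Or.inr (EReal.coe_ne_top _))
  -- With e = ‖x₀ - z‖ and d = ‖y - z‖, the quadratic gain τ/2 (d² - e²) outweighs the affine loss
  -- ‖v₀‖(d + e) as soon as d - e ≥ 2‖v₀‖/τ. This fixes the radius.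
  have hx₀ : x₀ ∈ Metric.closedBall z (‖x₀ - z‖ + 2 * ‖v₀‖ / τ) := by
    rw [mem_closedBall_iff_norm]
    have : 0 ≤ 2 * ‖v₀‖ / τ := by positivity
    linarith
  obtain ⟨p, -, hmin⟩ := LowerSemicontinuousOn.exists_isMinOn ⟨x₀, hx₀⟩
    (isCompact_closedBall z _) (hlsc.lowerSemicontinuousOn _)
  refine ⟨p, fun y => ?_⟩
  by_cases hy : y ∈ Metric.closedBall z (‖x₀ - z‖ + 2 * ‖v₀‖ / τ)
  · exact hmin hy
  refine (hmin hx₀).trans ?_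
  have h1 := hv y
  rw [ha] at h1
  refine le_trans ?_ (add_le_add_left h1 _)
  simp only [ha]
  norm_cast
  rw [mem_closedBall_iff_norm, not_le] at hy
  have h2 : |inner ℝ v₀ (y - x₀)| ≤ ‖v₀‖ * (‖y - z‖ + ‖x₀ - z‖) := by
    refine (abs_real_inner_le_norm _ _).trans ?_
    gcongr
    rw [show y - x₀ = (y - z) - (x₀ - z) by abel]
    exact norm_sub_le _ _
  have h3 := neg_le_of_abs_le h2
  set e := ‖x₀ - z‖
  set d := ‖y - z‖
  have he0 : 0 ≤ e := norm_nonneg _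
  have hn : 0 ≤ ‖v₀‖ := norm_nonneg _
  have h4 : τ * (2 * ‖v₀‖ / τ) = 2 * ‖v₀‖ := by field_simp
  have h6 : τ * e + 2 * ‖v₀‖ ≤ τ * d := by
    have := mul_le_mul_of_nonneg_left hy.le hτ.le
    rw [mul_add, h4] at this
    exact this
  have h5 : e ≤ d := by
    have : 0 ≤ 2 * ‖v₀‖ / τ := by positivity
    linarith
  have h7 := mul_le_mul_of_nonneg_right h6 (he0.trans h5)
  have h8 := mul_le_mul_of_nonneg_left h5 (mul_nonneg hτ.le he0)
  have h9 := mul_le_mul_of_nonneg_left h6 he0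
  nlinarith

end ProperClosedConvex

theorem le_conjugate (G : E → EReal) (u x : E) :
    ((inner ℝ u x : ℝ) : EReal) - G x ≤ conjugate G u :=
  le_iSup (fun x => ((inner ℝ u x : ℝ) : EReal) - G x) x

theorem conjugate_eq_of_mem_subdiff {G : E → EReal} {x v : E} (hv : v ∈ subdiff G x) {a : ℝ}
    (ha : G x = a) : conjugate G v = ((inner ℝ v x - a : ℝ) : EReal) := by
  refine le_antisymm (iSup_le fun y => ?_) ?_
  · have h := hv y
    rw [ha, ← EReal.coe_add] at h
    calc ((inner ℝ v y : ℝ) : EReal) - G y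
        ≤ ((inner ℝ v y : ℝ) : EReal) - ((a + inner ℝ v (y - x) : ℝ) : EReal) :=
          EReal.sub_le_sub le_rfl h
      _ = ((inner ℝ v x - a : ℝ) : EReal) := by
          rw [← EReal.coe_sub, inner_sub_right]; congr 1; ring
  · have := le_conjugate G v x
    rwa [ha, ← EReal.coe_sub] at this

/-- Moreau's decomposition, obtained without biconjugation: the primal proximal point y of z/τ
yields v = z - τy ∈ ∂G(y). The Fenchel inequality at p and Fenchel equality at v, inserted in the
minimality of p, force p = v. -/
theorem ProperClosedConvex.mem_subdiff_of_isProx_conjugate [FiniteDimensional ℝ E]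
    {G : E → EReal} (hG : ProperClosedConvex G) {x₀ v₀ : E} (hv₀ : v₀ ∈ subdiff G x₀)
    {τ : ℝ} (hτ : 0 < τ) {z p : E} (hp : IsProx τ (conjugate G) z p) :
    p ∈ subdiff G ((1 / τ) • (z - p)) := by
  obtain ⟨y, hy⟩ := hG.exists_forall_add_sq_le hv₀ hτ ((1 / τ) • z)
  have hv := hG.smul_sub_mem_subdiff hy
  rw [smul_sub, smul_smul, mul_one_div_cancel hτ.ne', one_smul] at hv
  set v := z - τ • y with hvdef
  obtain ⟨a, ha⟩ := hG.exists_coe_of_mem_subdiff hv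
  have h1 := hp v
  have h2 := le_conjugate G p y
  rw [conjugate_eq_of_mem_subdiff hv ha] at h1
  rw [ha, ← EReal.coe_sub] at h2
  have h3 : ((τ * (inner ℝ p y - a) + ‖p - z‖ ^ 2 / 2 : ℝ) : EReal) ≤
      ((τ * (inner ℝ v y - a) + ‖v - z‖ ^ 2 / 2 : ℝ) : EReal) := by
    have h4 : (τ : EReal) * ((inner ℝ p y - a : ℝ) : EReal) ≤ (τ : EReal) * conjugate G p :=
      mul_le_mul_of_nonneg_left h2 (EReal.coe_nonneg.2 hτ.le)
    have h5 := (add_le_add_left h4 ((‖p - z‖ ^ 2 / 2 : ℝ) : EReal)).trans h1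
    exact_mod_cast h5
  rw [EReal.coe_le_coe_iff] at h3
  have h6 : p - z = (p - v) - τ • y := by rw [hvdef]; abel
  have h7 : v - z = -(τ • y) := by rw [hvdef]; abel
  rw [h6, h7, norm_neg, norm_sub_sq_real, inner_smul_right, inner_sub_left] at h3
  have h8 : ‖p - v‖ ^ 2 ≤ 0 := by linarith
  have h9 : p = v := by
    rw [← sub_eq_zero, ← norm_eq_zero]
    exact pow_eq_zero_iff two_ne_zero |>.1 (le_antisymm h8 (sq_nonneg _))
  have h10 : (1 / τ) • (z - p) = y := by
    rw [h9, hvdef, sub_sub_cancel, smul_smul, one_div_mul_cancel hτ.ne', one_smul]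
  rw [h10, h9]
  exact hv

/-! ### Convex functions with Lipschitz gradient -/

section Smooth

variable [CompleteSpace E] {L : ℝ} {f : E → ℝ}

theorem hasDerivAt_comp_line (hf : Differentiable ℝ f) (x d : E) (t : ℝ) :
    HasDerivAt (fun t : ℝ => f (x + t • d)) (inner ℝ (gradient f (x + t • d)) d) t := by
  have h1 : HasDerivAt (fun t : ℝ => x + t • d) d t := by
    simpa using ((hasDerivAt_id t).smul_const d).const_add x
  have h2 := (hf (x + t • d)).hasGradientAt.hasFDerivAt
  exact h2.comp_hasDerivAt t h1

theorem ConvexOn.add_inner_gradient_le (hconv : ConvexOn ℝ Set.univ f) (hf : Differentiable ℝ f)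
    (x y : E) : f x + inner ℝ (gradient f x) (y - x) ≤ f y := by
  have h0 := hasDerivAt_comp_line hf x (y - x) 0
  rw [zero_smul, add_zero] at h0
  have h1 : Tendsto (fun t : ℝ => t⁻¹ • (f (x + t • (y - x)) - f x)) (𝓝[>] 0)
      (𝓝 (inner ℝ (gradient f x) (y - x))) := by
    have := h0.tendsto_slope_zero_right
    simpa using this
  suffices inner ℝ (gradient f x) (y - x) ≤ f y - f x by linarith
  refine le_of_tendsto h1 ?_
  filter_upwards [Ioo_mem_nhdsGT (zero_lt_one' ℝ)] with t ht
  have h2 := hconv.2 (Set.mem_univ x) (Set.mem_univ y) (sub_nonneg.2 ht.2.le) ht.1.le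
    (sub_add_cancel 1 t)
  have h3 : (1 - t) • x + t • y = x + t • (y - x) := by module
  rw [h3] at h2
  simp only [smul_eq_mul] at h2 ⊢
  rw [inv_mul_le_iff₀ ht.1]
  linarith

theorem IsLSmooth.le_add_inner_add_sq (hf : IsLSmooth L f) (x y : E) :
    f y ≤ f x + inner ℝ (gradient f x) (y - x) + L / 2 * ‖y - x‖ ^ 2 := by
  set d := y - x with hd
  let φ : ℝ → ℝ := fun t => f (x + t • d) - t * inner ℝ (gradient f x) d - L / 2 * ‖d‖ ^ 2 * t ^ 2
  have hφ : ∀ t, HasDerivAt φ (inner ℝ (gradient f (x + t • d)) d - inner ℝ (gradient f x) d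
      - L / 2 * ‖d‖ ^ 2 * (2 * t)) t := by
    intro t
    refine ((hasDerivAt_comp_line hf.differentiable x d t).sub ?_).sub ?_
    · simpa using (hasDerivAt_id t).mul_const (inner ℝ (gradient f x) d)
    · simpa using (hasDerivAt_pow 2 t).const_mul (L / 2 * ‖d‖ ^ 2)
  have hanti : AntitoneOn φ (Set.Icc 0 1) := by
    refine antitoneOn_of_deriv_nonpos (convex_Icc 0 1)
      (fun t _ => (hφ t).continuousAt.continuousWithinAt)
      (fun t _ => (hφ t).differentiableAt.differentiableWithinAt) fun t ht => ?_
    rw [interior_Icc] at ht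
    rw [(hφ t).deriv, ← inner_sub_left]
    have h1 := real_inner_le_norm (gradient f (x + t • d) - gradient f x) d
    have h2 := hf.lipschitz (x + t • d) x
    rw [add_sub_cancel_left, norm_smul, Real.norm_eq_abs, abs_of_pos ht.1] at h2
    have h3 := mul_le_mul_of_nonneg_right h2 (norm_nonneg d)
    nlinarith
  have := hanti (Set.left_mem_Icc.2 zero_le_one) (Set.right_mem_Icc.2 zero_le_one) zero_le_one
  simp only [φ, one_smul, zero_smul, add_zero, hd, add_sub_cancel] at this
  simp only [hd]
  linarith

/-- Evaluate f at the gradient step y - w/L, where w is the gradient difference: convexity at x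
bounds this value below, the descent lemma at y bounds it above. -/
theorem IsLSmooth.add_sq_gradient_le (hL : 0 < L) (hf : IsLSmooth L f)
    (hconv : ConvexOn ℝ Set.univ f) (x y : E) :
    f x + inner ℝ (gradient f x) (y - x) + 1 / (2 * L) * ‖gradient f y - gradient f x‖ ^ 2
      ≤ f y := by
  set w := gradient f y - gradient f x with hw
  have h1 := hconv.add_inner_gradient_le hf.differentiable x (y - (1 / L) • w)
  have h2 := hf.le_add_inner_add_sq y (y - (1 / L) • w)
  have e1 : y - (1 / L) • w - x = (y - x) - (1 / L) • w := by abel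
  have e2 : y - (1 / L) • w - y = -((1 / L) • w) := by abel
  rw [e1, inner_sub_right, inner_smul_right] at h1
  rw [e2, inner_neg_right, inner_smul_right, norm_neg, norm_smul, mul_pow, Real.norm_eq_abs,
    sq_abs] at h2
  have e3 : (inner ℝ (gradient f y) w : ℝ) - inner ℝ (gradient f x) w = ‖w‖ ^ 2 := by
    rw [← inner_sub_left, ← hw, real_inner_self_eq_norm_sq]
  have e4 : L / 2 * ((1 / L) ^ 2 * ‖w‖ ^ 2) = 1 / (2 * L) * ‖w‖ ^ 2 := by field_simp
  have e5 : 1 / L * (inner ℝ (gradient f y) w : ℝ) - 1 / L * inner ℝ (gradient f x) w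
      = 2 * (1 / (2 * L) * ‖w‖ ^ 2) := by
    rw [← mul_sub, e3]; field_simp
  rw [e4] at h2
  linarith

/-- The Baillon–Haddad inequality. -/
theorem IsLSmooth.sq_gradient_sub_le_inner (hL : 0 < L) (hf : IsLSmooth L f)
    (hconv : ConvexOn ℝ Set.univ f) (x y : E) :
    1 / L * ‖gradient f x - gradient f y‖ ^ 2
      ≤ inner ℝ (gradient f x - gradient f y) (x - y) := by
  have h1 := hf.add_sq_gradient_le hL hconv x y
  have h2 := hf.add_sq_gradient_le hL hconv y x
  rw [norm_sub_rev (gradient f y), ← neg_sub x y, inner_neg_right] at h1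
  have e : 1 / L * ‖gradient f x - gradient f y‖ ^ 2
      = 2 * (1 / (2 * L) * ‖gradient f x - gradient f y‖ ^ 2) := by field_simp
  rw [e, inner_sub_left]
  linarith

theorem gradient_eq_of_mem_subdiff (hf : Differentiable ℝ f) {G : E → EReal}
    (hG : ∀ x, G x = (f x : EReal)) {x v : E} (hv : v ∈ subdiff G x) : gradient f x = v := by
  have hmin : ∀ z, f x - inner ℝ v x ≤ f z - inner ℝ v z := by
    intro z
    have := hv z
    rw [hG, hG, ← EReal.coe_add, EReal.coe_le_coe_iff, inner_sub_right] at this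
    linarith
  have h1 : HasFDerivAt (fun z => f z - inner ℝ v z)
      (InnerProductSpace.toDual ℝ E (gradient f x) - InnerProductSpace.toDual ℝ E v) x :=
    (hf x).hasGradientAt.hasFDerivAt.sub (InnerProductSpace.toDual ℝ E v).hasFDerivAt
  have h2 := IsLocalMin.hasFDerivAt_eq_zero (Filter.Eventually.of_forall hmin) h1
  rw [← map_sub] at h2
  exact sub_eq_zero.1 ((LinearIsometryEquiv.map_eq_zero_iff _).1 h2)

end Smooth

end ConvexAnalysis

/-! ### The PD3O step, its quadratic form and saddle points -/

section PD3O

local postfix:max "†" => ContinuousLinearMap.adjoint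

variable {X U : Type*}
  [NormedAddCommGroup X] [InnerProductSpace ℝ X] [CompleteSpace X]
  [NormedAddCommGroup U] [InnerProductSpace ℝ U] [CompleteSpace U]

/-- The quadratic form `‖s‖² + η ‖u‖² - ‖K* u‖²` in which the PD3O iteration is averaged. -/
noncomputable def pd3oForm (K : X →L[ℝ] U) (η : ℝ) (s : X) (u : U) : ℝ :=
  ‖s‖ ^ 2 + (η * ‖u‖ ^ 2 - ‖K† u‖ ^ 2)

section Form

variable {K : X →L[ℝ] U} {η : ℝ}

theorem sq_norm_adjoint_le (hη : ‖K‖ ^ 2 ≤ η) (u : U) : ‖K† u‖ ^ 2 ≤ η * ‖u‖ ^ 2 := by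
  have h := (K†).le_opNorm u
  rw [LinearIsometryEquiv.norm_map] at h
  calc ‖K† u‖ ^ 2 ≤ (‖K‖ * ‖u‖) ^ 2 := by gcongr
    _ = ‖K‖ ^ 2 * ‖u‖ ^ 2 := mul_pow _ _ _
    _ ≤ η * ‖u‖ ^ 2 := by gcongr

theorem sq_norm_le_pd3oForm (hη : ‖K‖ ^ 2 ≤ η) (s : X) (u : U) :
    ‖s‖ ^ 2 ≤ pd3oForm K η s u := by
  have := sq_norm_adjoint_le hη u
  rw [pd3oForm]; linarith

theorem pd3oForm_nonneg (hη : ‖K‖ ^ 2 ≤ η) (s : X) (u : U) : 0 ≤ pd3oForm K η s u :=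
  (sq_nonneg _).trans (sq_norm_le_pd3oForm hη s u)

/-- The operator M = η - KK* satisfies ‖Mu‖² ≤ η⟨Mu, u⟩, so the residual y - Kx is controlled by Q
even when Q is degenerate. -/
theorem sq_norm_map_sub_le (hη : ‖K‖ ^ 2 ≤ η) (s : X) (u : U) :
    ‖K s - (η • u - K (K† u))‖ ^ 2 ≤ 2 * η * pd3oForm K η s u := by
  have hη₀ : 0 ≤ η := (sq_nonneg _).trans hη
  have hK : ∀ v : X, ‖K v‖ ^ 2 ≤ η * ‖v‖ ^ 2 := fun v =>
    calc ‖K v‖ ^ 2 ≤ (‖K‖ * ‖v‖) ^ 2 := by gcongr; exact K.le_opNorm v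
      _ = ‖K‖ ^ 2 * ‖v‖ ^ 2 := mul_pow _ _ _
      _ ≤ η * ‖v‖ ^ 2 := by gcongr
  have h1 := hK s
  have h2 : ‖η • u - K (K† u)‖ ^ 2 ≤ η * (η * ‖u‖ ^ 2 - ‖K† u‖ ^ 2) := by
    have h3 := hK (K† u)
    rw [norm_sub_sq_real, norm_smul, mul_pow, Real.norm_eq_abs, sq_abs, real_inner_smul_left,
      ← ContinuousLinearMap.adjoint_inner_left, real_inner_self_eq_norm_sq]
    nlinarith
  have h4 : ‖K s - (η • u - K (K† u))‖ ^ 2 ≤ 2 * (‖K s‖ ^ 2 + ‖η • u - K (K† u)‖ ^ 2) := by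
    have := parallelogram_law_with_norm ℝ (K s) (η • u - K (K† u))
    nlinarith [norm_nonneg (K s + (η • u - K (K† u)))]
  rw [pd3oForm]
  linarith

/-- The hypotheses are linear in all variables and involve no subgradients, so the identity applies
to differences of steps. It expands ⟨s', s' - s⟩ + ⟨u', M(u' - u)⟩, with M = η - KK*, through the
formulas for s' and y. -/
theorem pd3oForm_step_eq {γ : ℝ} (hγ : γ ≠ 0) {s s' x g : X} {u u' y : U}
    (hs : s' = (1 / γ) • x - g - K† u')
    (hy : y = K x + γ • (K (s' - s) - (η • (u' - u) - K (K† (u' - u))))) :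
    pd3oForm K η s' u' = pd3oForm K η s u - pd3oForm K η (s' - s) (u' - u)
      - 2 / γ * (inner ℝ g x + inner ℝ (s - (1 / γ) • x) x + inner ℝ u' y)
      - 2 * inner ℝ (s' - s) g := by
  have e1 : (inner ℝ u' y : ℝ) = inner ℝ (K† u') x + γ * (inner ℝ (K† u') (s' - s)
      - (η * inner ℝ u' (u' - u) - inner ℝ (K† u') (K† (u' - u)))) := by
    simp only [hy, map_sub, inner_add_right, inner_sub_right, inner_smul_right,
      ContinuousLinearMap.adjoint_inner_left]
  have e2 : pd3oForm K η s' u' - pd3oForm K η s u + pd3oForm K η (s' - s) (u' - u)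
      = 2 * inner ℝ s' (s' - s) + 2 * (η * inner ℝ u' (u' - u)
        - inner ℝ (K† u') (K† (u' - u))) := by
    simp only [pd3oForm, map_sub, norm_sub_sq_real, inner_sub_right, real_inner_self_eq_norm_sq]
    ring
  have e3 : (inner ℝ s' (s' - s) : ℝ) = 1 / γ * inner ℝ x (s' - s) - inner ℝ (s' - s) g
      - inner ℝ (K† u') (s' - s) := by
    rw [real_inner_comm g (s' - s), ← real_inner_smul_left, ← inner_sub_left,
      ← inner_sub_left, ← hs]
  have e4 : (inner ℝ x (s' - s) : ℝ)
      = - (inner ℝ g x + inner ℝ (s - (1 / γ) • x) x + inner ℝ (K† u') x) := by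
    rw [← inner_add_left, ← inner_add_left, ← inner_neg_left, real_inner_comm, hs]
    congr 1; abel
  have e5 : 2 / γ * (inner ℝ g x + inner ℝ (s - (1 / γ) • x) x + inner ℝ u' y)
      = 2 / γ * (inner ℝ g x + inner ℝ (s - (1 / γ) • x) x + inner ℝ (K† u') x)
        + 2 * (inner ℝ (K† u') (s' - s)
      - (η * inner ℝ u' (u' - u) - inner ℝ (K† u') (K† (u' - u)))) := by
    rw [e1]; field_simp; ring
  have e6 : 2 * (1 / γ * inner ℝ x (s' - s))
      = - (2 / γ * (inner ℝ g x + inner ℝ (s - (1 / γ) • x) x + inner ℝ (K† u') x)) := by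
    rw [e4]; ring
  linarith

end Form

/-- One PD3O step from `(s, u)` to `(s', u')`, written with subgradients; here `s = q - K* u`. -/
structure PD3OStep (F : X → ℝ) (R : X → EReal) (H : U → EReal) (K : X →L[ℝ] U) (γ η : ℝ)
    (s : X) (u : U) (x : X) (y : U) (s' : X) (u' : U) : Prop where
  mem_R : s - (1 / γ) • x ∈ subdiff R x
  mem_H : u' ∈ subdiff H y
  s_eq : s' = (1 / γ) • x - gradient F x - K† u'
  y_eq : y = K x + γ • (K (s' - s) - (η • (u' - u) - K (K† (u' - u))))

namespace PD3OStep

variable {F : X → ℝ} {R : X → EReal} {H : U → EReal} {K : X →L[ℝ] U} {γ η L : ℝ}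
  {s₁ s₂ x₁ x₂ s₁' s₂' : X} {u₁ u₂ y₁ y₂ u₁' u₂' : U}

theorem pd3oForm_sub_eq (hγ : 0 < γ) (h₁ : PD3OStep F R H K γ η s₁ u₁ x₁ y₁ s₁' u₁')
    (h₂ : PD3OStep F R H K γ η s₂ u₂ x₂ y₂ s₂' u₂') :
    pd3oForm K η (s₁' - s₂') (u₁' - u₂') = pd3oForm K η (s₁ - s₂) (u₁ - u₂)
      - pd3oForm K η ((s₁' - s₁) - (s₂' - s₂)) ((u₁' - u₁) - (u₂' - u₂))
      - 2 / γ * (inner ℝ (gradient F x₁ - gradient F x₂) (x₁ - x₂)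
        + inner ℝ ((s₁ - (1 / γ) • x₁) - (s₂ - (1 / γ) • x₂)) (x₁ - x₂)
        + inner ℝ (u₁' - u₂') (y₁ - y₂))
      - 2 * inner ℝ ((s₁' - s₁) - (s₂' - s₂)) (gradient F x₁ - gradient F x₂) := by
  have e : (s₁ - (1 / γ) • x₁) - (s₂ - (1 / γ) • x₂) = (s₁ - s₂) - (1 / γ) • (x₁ - x₂) := by
    module
  have e1 : (s₁' - s₁) - (s₂' - s₂) = (s₁' - s₂') - (s₁ - s₂) := by abel
  have e2 : (u₁' - u₁) - (u₂' - u₂) = (u₁' - u₂') - (u₁ - u₂) := by abel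
  rw [e, e1, e2]
  refine pd3oForm_step_eq hγ.ne' ?_ ?_
  · rw [h₁.s_eq, h₂.s_eq, map_sub]; module
  · rw [h₁.y_eq, h₂.y_eq]; simp only [map_sub]; module

theorem inner_mem_R_nonneg (hR : ProperClosedConvex R)
    (h₁ : PD3OStep F R H K γ η s₁ u₁ x₁ y₁ s₁' u₁')
    (h₂ : PD3OStep F R H K γ η s₂ u₂ x₂ y₂ s₂' u₂') :
    0 ≤ (inner ℝ ((s₁ - (1 / γ) • x₁) - (s₂ - (1 / γ) • x₂)) (x₁ - x₂) : ℝ) :=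
  hR.inner_subdiff_nonneg h₁.mem_R h₂.mem_R

theorem inner_mem_H_nonneg (hH : ProperClosedConvex H)
    (h₁ : PD3OStep F R H K γ η s₁ u₁ x₁ y₁ s₁' u₁')
    (h₂ : PD3OStep F R H K γ η s₂ u₂ x₂ y₂ s₂' u₂') :
    0 ≤ (inner ℝ (u₁' - u₂') (y₁ - y₂) : ℝ) :=
  hH.inner_subdiff_nonneg h₁.mem_H h₂.mem_H

/-- Here x is the proximal point of γs for γR, and proximal maps are nonexpansive. -/
theorem norm_sub_le (hγ : 0 < γ) (hR : ProperClosedConvex R)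
    (h₁ : PD3OStep F R H K γ η s₁ u₁ x₁ y₁ s₁' u₁')
    (h₂ : PD3OStep F R H K γ η s₂ u₂ x₂ y₂ s₂' u₂') : ‖x₁ - x₂‖ ≤ γ * ‖s₁ - s₂‖ := by
  have h := inner_mem_R_nonneg hR h₁ h₂
  have e : (s₁ - (1 / γ) • x₁) - (s₂ - (1 / γ) • x₂) = (s₁ - s₂) - (1 / γ) • (x₁ - x₂) := by
    module
  rw [e, inner_sub_left, real_inner_smul_left, real_inner_self_eq_norm_sq] at h
  have h1 := real_inner_le_norm (s₁ - s₂) (x₁ - x₂)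
  have h2 : 1 / γ * ‖x₁ - x₂‖ ^ 2 ≤ ‖s₁ - s₂‖ * ‖x₁ - x₂‖ := by linarith
  rcases (norm_nonneg (x₁ - x₂)).eq_or_lt with h0 | h0
  · rw [← h0]; positivity
  · have h3 : 1 / γ * ‖x₁ - x₂‖ ≤ ‖s₁ - s₂‖ := by
      refine le_of_mul_le_mul_right ?_ h0
      linarith
    rwa [one_div, inv_mul_le_iff₀ hγ] at h3

/-- Decrease of the form between two steps: the PD3O operator is averaged. -/
theorem pd3oForm_add_le (hL : 0 < L) (hFc : ConvexOn ℝ Set.univ F) (hF : IsLSmooth L F)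
    (hR : ProperClosedConvex R)
    (hγ : 0 < γ) (hγL : γ < 2 / L) (hη : ‖K‖ ^ 2 ≤ η) :
    ∃ c > 0, ∀ {s₁ s₂ x₁ x₂ s₁' s₂' : X} {u₁ u₂ y₁ y₂ u₁' u₂' : U},
      PD3OStep F R H K γ η s₁ u₁ x₁ y₁ s₁' u₁' → PD3OStep F R H K γ η s₂ u₂ x₂ y₂ s₂' u₂' →
      pd3oForm K η (s₁' - s₂') (u₁' - u₂')
        + c * pd3oForm K η ((s₁' - s₁) - (s₂' - s₂)) ((u₁' - u₁) - (u₂' - u₂))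
        + c * ‖gradient F x₁ - gradient F x₂‖ ^ 2 + 2 / γ * inner ℝ (u₁' - u₂') (y₁ - y₂)
      ≤ pd3oForm K η (s₁ - s₂) (u₁ - u₂) := by
  -- Cocoercivity yields 1/β times the squared gradient difference. Young's inequality with weight θ
  -- costs θ on the increment and 1/θ on the gradient, so β < θ < 1 leaves a positive margin on
  -- both.
  set β := γ * L / 2 with hβdef
  have hβ0 : 0 < β := by positivity
  have hβ1 : β < 1 := by
    rw [lt_div_iff₀ hL] at hγL
    rw [hβdef]; linarith
  set θ := (β + 1) / 2 with hθ
  have hθ0 : 0 < θ := by positivity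
  have hc : 0 < min (1 - θ) (1 / β - 1 / θ) := by
    refine lt_min (by linarith) (sub_pos.2 ?_)
    exact one_div_lt_one_div_of_lt hβ0 (by linarith)
  refine ⟨_, hc, fun {s₁ s₂ x₁ x₂ s₁' s₂' u₁ u₂ y₁ y₂ u₁' u₂'} h₁ h₂ => ?_⟩
  set c := min (1 - θ) (1 / β - 1 / θ)
  have hc1 : c ≤ 1 - θ := min_le_left _ _
  have hc2 : c ≤ 1 / β - 1 / θ := min_le_right _ _
  rw [pd3oForm_sub_eq hγ h₁ h₂]
  have hr := inner_mem_R_nonneg hR h₁ h₂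
  have hg := hF.sq_gradient_sub_le_inner hL hFc x₁ x₂
  set w := (s₁' - s₁) - (s₂' - s₂)
  set Q := pd3oForm K η w ((u₁' - u₁) - (u₂' - u₂))
  have hw : ‖w‖ ^ 2 ≤ Q := sq_norm_le_pd3oForm hη _ _
  have hQ0 : 0 ≤ Q := pd3oForm_nonneg hη _ _
  set g := gradient F x₁ - gradient F x₂
  have hy : -(2 * inner ℝ w g) ≤ θ * ‖w‖ ^ 2 + 1 / θ * ‖g‖ ^ 2 := by
    have h1 : |inner ℝ w g| ≤ ‖w‖ * ‖g‖ := abs_real_inner_le_norm w g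
    have h2 := neg_le_of_abs_le h1
    have h3 : 0 ≤ 1 / θ * (θ * ‖w‖ - ‖g‖) ^ 2 := by positivity
    have h4 : 1 / θ * (θ * ‖w‖ - ‖g‖) ^ 2
        = θ * ‖w‖ ^ 2 + 1 / θ * ‖g‖ ^ 2 - 2 * (‖w‖ * ‖g‖) := by field_simp; ring
    linarith
  have h5 : 1 / β * ‖g‖ ^ 2 ≤ 2 / γ * inner ℝ g (x₁ - x₂) := by
    have e : 1 / β * ‖g‖ ^ 2 = 2 / γ * (1 / L * ‖g‖ ^ 2) := by rw [hβdef]; field_simp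
    rw [e]; gcongr
  have h6 := mul_nonneg (show 0 ≤ 2 / γ by positivity) hr
  have h7 := mul_le_mul_of_nonneg_right hc1 hQ0
  have h8 := mul_le_mul_of_nonneg_right hc2 (sq_nonneg ‖g‖)
  have h9 := mul_le_mul_of_nonneg_left hw hθ0.le
  linarith

theorem pd3oForm_le (hL : 0 < L) (hFc : ConvexOn ℝ Set.univ F) (hF : IsLSmooth L F)
    (hR : ProperClosedConvex R) (hH : ProperClosedConvex H)
    (hγ : 0 < γ) (hγL : γ < 2 / L) (hη : ‖K‖ ^ 2 ≤ η)
    (h₁ : PD3OStep F R H K γ η s₁ u₁ x₁ y₁ s₁' u₁')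
    (h₂ : PD3OStep F R H K γ η s₂ u₂ x₂ y₂ s₂' u₂') :
    pd3oForm K η (s₁' - s₂') (u₁' - u₂') ≤ pd3oForm K η (s₁ - s₂) (u₁ - u₂) := by
  obtain ⟨c, hc, h⟩ := pd3oForm_add_le (H := H) hL hFc hF hR hγ hγL hη
  have := h h₁ h₂
  have h1 := mul_nonneg hc.le
    (pd3oForm_nonneg hη ((s₁' - s₁) - (s₂' - s₂)) ((u₁' - u₁) - (u₂' - u₂)))
  have h2 := mul_nonneg hc.le (sq_nonneg ‖gradient F x₁ - gradient F x₂‖)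
  have h3 := mul_nonneg (show 0 ≤ 2 / γ by positivity) (inner_mem_H_nonneg hH h₁ h₂)
  linarith

/-- Upper bound on the monotonicity products: in the step identity, -‖w‖² - 2⟨w, g⟩ ≤ ‖g‖² by
completing the square. -/
theorem inner_add_le (hγ : 0 < γ) (hη : ‖K‖ ^ 2 ≤ η)
    (h₁ : PD3OStep F R H K γ η s₁ u₁ x₁ y₁ s₁' u₁')
    (h₂ : PD3OStep F R H K γ η s₂ u₂ x₂ y₂ s₂' u₂') :
    inner ℝ (gradient F x₁ - gradient F x₂) (x₁ - x₂)
        + inner ℝ ((s₁ - (1 / γ) • x₁) - (s₂ - (1 / γ) • x₂)) (x₁ - x₂)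
        + inner ℝ (u₁' - u₂') (y₁ - y₂)
      ≤ γ / 2 * (pd3oForm K η (s₁ - s₂) (u₁ - u₂) - pd3oForm K η (s₁' - s₂') (u₁' - u₂')
        + ‖gradient F x₁ - gradient F x₂‖ ^ 2) := by
  have h := pd3oForm_sub_eq hγ h₁ h₂
  have hw := sq_norm_le_pd3oForm hη ((s₁' - s₁) - (s₂' - s₂)) ((u₁' - u₁) - (u₂' - u₂))
  have h1 := norm_add_sq_real ((s₁' - s₁) - (s₂' - s₂)) (gradient F x₁ - gradient F x₂)
  have h2 := sq_nonneg ‖(s₁' - s₁) - (s₂' - s₂) + (gradient F x₁ - gradient F x₂)‖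
  rw [← div_le_iff₀' (by positivity), div_eq_inv_mul, inv_div]
  linarith

/-- When η = ‖K‖², Q need not control u. After one step it does: K*u' = x/γ - ∇F(x) - s' is bounded
by earlier quantities, and η‖u'‖² is at most Q plus ‖K*u'‖². -/
theorem sq_norm_sub_dual_le (hL : 0 < L) (hFc : ConvexOn ℝ Set.univ F) (hF : IsLSmooth L F)
    (hR : ProperClosedConvex R) (hH : ProperClosedConvex H)
    (hγ : 0 < γ) (hγL : γ < 2 / L) (hη : ‖K‖ ^ 2 ≤ η)
    (h₁ : PD3OStep F R H K γ η s₁ u₁ x₁ y₁ s₁' u₁')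
    (h₂ : PD3OStep F R H K γ η s₂ u₂ x₂ y₂ s₂' u₂') :
    η * ‖u₁' - u₂'‖ ^ 2 ≤ (1 + (2 + L * γ) ^ 2) * pd3oForm K η (s₁ - s₂) (u₁ - u₂) := by
  have hQ := pd3oForm_le hL hFc hF hR hH hγ hγL hη h₁ h₂
  set Q := pd3oForm K η (s₁ - s₂) (u₁ - u₂)
  have hQ0 : 0 ≤ Q := pd3oForm_nonneg hη _ _
  have hs : ‖s₁ - s₂‖ ≤ √Q := Real.le_sqrt_of_sq_le (sq_norm_le_pd3oForm hη _ _)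
  have hs' : ‖s₁' - s₂'‖ ≤ √Q := Real.le_sqrt_of_sq_le ((sq_norm_le_pd3oForm hη _ _).trans hQ)
  have hx := norm_sub_le hγ hR h₁ h₂
  have hg := hF.lipschitz x₁ x₂
  have e : K† (u₁' - u₂') = (1 / γ) • (x₁ - x₂) - (gradient F x₁ - gradient F x₂)
      - (s₁' - s₂') := by
    rw [map_sub, h₁.s_eq, h₂.s_eq]; module
  have hK : ‖K† (u₁' - u₂')‖ ≤ (2 + L * γ) * √Q := by
    rw [e]
    refine (_root_.norm_sub_le _ _).trans ?_
    have h1 := _root_.norm_sub_le ((1 / γ) • (x₁ - x₂)) (gradient F x₁ - gradient F x₂)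
    have h2 : ‖(1 / γ) • (x₁ - x₂)‖ ≤ ‖s₁ - s₂‖ := by
      rw [norm_smul, Real.norm_eq_abs, abs_of_pos (by positivity), one_div,
        inv_mul_le_iff₀ hγ]
      exact hx
    have h3 := mul_le_mul_of_nonneg_left (hx.trans (mul_le_mul_of_nonneg_left hs hγ.le)) hL.le
    linarith
  have hK2 : ‖K† (u₁' - u₂')‖ ^ 2 ≤ (2 + L * γ) ^ 2 * Q := by
    calc _ ≤ ((2 + L * γ) * √Q) ^ 2 := by gcongr
      _ = _ := by rw [mul_pow, Real.sq_sqrt hQ0]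
  have := sq_nonneg ‖s₁' - s₂'‖
  have h4 : ‖s₁' - s₂'‖ ^ 2 + (η * ‖u₁' - u₂'‖ ^ 2 - ‖K† (u₁' - u₂')‖ ^ 2) ≤ Q := hQ
  linarith

theorem sq_norm_sub_map_le (hη : ‖K‖ ^ 2 ≤ η)
    (h₁ : PD3OStep F R H K γ η s₁ u₁ x₁ y₁ s₁' u₁') :
    ‖y₁ - K x₁‖ ^ 2 ≤ γ ^ 2 * (2 * η) * pd3oForm K η (s₁' - s₁) (u₁' - u₁) := by
  rw [h₁.y_eq, add_sub_cancel_left, norm_smul, mul_pow, Real.norm_eq_abs, sq_abs, mul_assoc]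
  gcongr
  exact sq_norm_map_sub_le hη _ _

end PD3OStep

/-- A pair satisfying the primal-dual optimality conditions. -/
structure IsSaddlePoint (F : X → ℝ) (R : X → EReal) (H : U → EReal) (K : X →L[ℝ] U)
    (x : X) (u : U) : Prop where
  mem_R : -gradient F x - K† u ∈ subdiff R x
  mem_H : u ∈ subdiff H (K x)

namespace IsSaddlePoint

variable {F : X → ℝ} {R : X → EReal} {H : U → EReal} {K : X →L[ℝ] U} {x : X} {u : U}

/-- Saddle points are fixed points of the step, so every two-step estimate also measures the
distance to a solution. -/
theorem pd3oStep (h : IsSaddlePoint F R H K x u) (γ η : ℝ) :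
    PD3OStep F R H K γ η ((1 / γ) • x - gradient F x - K† u) u x (K x)
      ((1 / γ) • x - gradient F x - K† u) u where
  mem_R := by
    convert h.mem_R using 1; abel
  mem_H := h.mem_H
  s_eq := rfl
  y_eq := by simp

theorem exists_values (h : IsSaddlePoint F R H K x u) (hR : ProperClosedConvex R)
    (hH : ProperClosedConvex H) : ∃ r t : ℝ, R x = r ∧ H (K x) = t := by
  obtain ⟨r, hr⟩ := hR.exists_coe_of_mem_subdiff h.mem_R
  obtain ⟨t, ht⟩ := hH.exists_coe_of_mem_subdiff h.mem_H
  exact ⟨r, t, hr, ht⟩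

theorem neg_adjoint_mem_subdiff (h : IsSaddlePoint F R H K x u) (hR : ProperClosedConvex R)
    (hFc : ConvexOn ℝ Set.univ F) (hF : Differentiable ℝ F) :
    -(K† u) ∈ subdiff (fun x => (F x : EReal) + R x) x := by
  intro y
  have h1 := h.mem_R y
  have h2 := hFc.add_inner_gradient_le hF x y
  obtain ⟨r, hr⟩ := hR.exists_coe_of_mem_subdiff h.mem_R
  by_cases hy : R y = ⊤
  · simp [hy]
  obtain ⟨b, hb⟩ := EReal.exists_coe_eq hy (hR.ne_bot y)
  simp only [hr, hb] at h1 ⊢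
  norm_cast at h1 ⊢
  rw [inner_sub_left, inner_neg_left] at h1
  rw [inner_neg_left]
  linarith

theorem isSolution_primalObj (h : IsSaddlePoint F R H K x u) (hR : ProperClosedConvex R)
    (hH : ProperClosedConvex H) (hFc : ConvexOn ℝ Set.univ F) (hF : Differentiable ℝ F) :
    IsSolution (primalObj F R H K) x := by
  obtain ⟨r, t, hr, ht⟩ := h.exists_values hR hH
  refine ⟨⟨F x + r + t, by rw [primalObj, hr, ht]; norm_cast⟩, fun y => ?_⟩
  have h1 := h.neg_adjoint_mem_subdiff hR hFc hF y
  have h2 := h.mem_H (K y)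
  have e : (inner ℝ (-(K† u)) (y - x) : ℝ) = -inner ℝ u (K y - K x) := by
    rw [inner_neg_left, ContinuousLinearMap.adjoint_inner_left, map_sub]
  rw [e] at h1
  refine le_trans (le_of_eq ?_) (add_le_add h1 h2)
  simp only [primalObj, hr, ht]
  norm_cast
  ring

/-- Fenchel equality makes the dual value at u the negative of the primal value at x; the Fenchel
inequality at x and Kx bounds every other dual value below by it. -/
theorem isSolution_dualObj (h : IsSaddlePoint F R H K x u) (hR : ProperClosedConvex R)
    (hH : ProperClosedConvex H) (hFc : ConvexOn ℝ Set.univ F) (hF : Differentiable ℝ F) :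
    IsSolution (dualObj F R H K) u := by
  obtain ⟨r, t, hr, ht⟩ := h.exists_values hR hH
  have hFR : (fun x => (F x : EReal) + R x) x = ((F x + r : ℝ) : EReal) := by simp [hr]
  have e1 := conjugate_eq_of_mem_subdiff (h.neg_adjoint_mem_subdiff hR hFc hF) hFR
  have e2 := conjugate_eq_of_mem_subdiff h.mem_H ht
  have e3 : dualObj F R H K u = ((-(F x + r + t) : ℝ) : EReal) := by
    rw [dualObj, e1, e2, ← EReal.coe_add, inner_neg_left,
      ContinuousLinearMap.adjoint_inner_left]
    congr 1; ring
  refine ⟨⟨_, e3⟩, fun v => ?_⟩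
  have h1 := le_conjugate (fun x => (F x : EReal) + R x) (-(K† v)) x
  have h2 := le_conjugate H v (K x)
  simp only [hr] at h1
  rw [ht] at h2
  rw [e3]
  refine le_trans (le_of_eq ?_) (add_le_add h1 h2)
  rw [inner_neg_left, ContinuousLinearMap.adjoint_inner_left]
  norm_cast
  ring

end IsSaddlePoint

end PD3O

/-! ### Summable monotone sequences, Abel summation and weighted means -/

section SequencesOfReals

theorem summable_of_le_sub_succ {a b : ℕ → ℝ} (ha : ∀ k, 0 ≤ a k) (hb : ∀ k, 0 ≤ b k)
    (h : ∀ k, a k ≤ b k - b (k + 1)) : Summable a := by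
  refine summable_of_sum_range_le (c := b 0) ha fun n => ?_
  refine (Finset.sum_le_sum fun k _ => h k).trans ?_
  rw [Finset.sum_range_sub']
  linarith [hb n]

/-- By monotonicity k·a(k)/2 is at most the block of the series from k/2 to k, which vanishes by the
Cauchy criterion. -/
theorem Antitone.tendsto_natCast_mul_of_summable {a : ℕ → ℝ} (ha : Antitone a)
    (h0 : ∀ k, 0 ≤ a k) (hs : Summable a) : Tendsto (fun k : ℕ => (k : ℝ) * a k) atTop (𝓝 0) := by
  have h1 := hs.hasSum.tendsto_sum_nat
  have h2 : Tendsto (fun k : ℕ => k / 2) atTop atTop := Nat.tendsto_div_const_atTop two_ne_zero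
  have h3 := (h1.sub (h1.comp h2)).const_mul 2
  rw [sub_self, mul_zero] at h3
  refine squeeze_zero (fun k => mul_nonneg k.cast_nonneg (h0 k)) (fun k => ?_) h3
  have h4 : ((k - k / 2 : ℕ) : ℝ) * a k ≤ ∑ i ∈ Finset.Ico (k / 2) k, a i := by
    rw [← nsmul_eq_mul, ← Nat.card_Ico (k / 2) k]
    exact Finset.card_nsmul_le_sum _ _ _ fun i hi => ha (Finset.mem_Ico.1 hi).2.le
  rw [Finset.sum_Ico_eq_sub _ (Nat.div_le_self k 2)] at h4
  have h5 : (k : ℝ) ≤ 2 * ((k - k / 2 : ℕ) : ℝ) := by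
    norm_cast; omega
  have h6 := mul_le_mul_of_nonneg_right h5 (h0 k)
  simp only [Function.comp_apply]
  linarith

theorem isLittleO_one_div_of_antitone_of_summable {a : ℕ → ℝ} (ha : Antitone fun k => a (k + 1))
    (h0 : ∀ k, 0 ≤ a (k + 1)) (hs : Summable fun k => a (k + 1)) :
    a =o[atTop] fun k : ℕ => 1 / (k : ℝ) := by
  rw [isLittleO_iff_tendsto']
  · rw [← tendsto_add_atTop_iff_nat 1]
    have h := (ha.tendsto_natCast_mul_of_summable h0 hs).add hs.tendsto_atTop_zero
    rw [add_zero] at h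
    refine h.congr fun k => ?_
    push_cast
    rw [div_div_eq_mul_div, div_one]
    ring
  · filter_upwards [eventually_ge_atTop 1] with k hk h
    have : (0 : ℝ) < k := by exact_mod_cast hk
    exact absurd h (by positivity)

theorem Asymptotics.IsLittleO.sqrt_one_div {a : ℕ → ℝ}
    (h : a =o[atTop] fun k : ℕ => 1 / (k : ℝ)) :
    (fun k => √(a k)) =o[atTop] fun k : ℕ => 1 / √(k : ℝ) := by
  have hne : ∀ᶠ k : ℕ in atTop, (1 / √(k : ℝ) = 0 → √(a k) = 0) := by
    filter_upwards [eventually_ge_atTop 1] with k hk h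
    have : (0 : ℝ) < k := by exact_mod_cast hk
    exact absurd h (by positivity)
  rw [isLittleO_iff_tendsto' hne]
  have h1 := (Real.continuous_sqrt.tendsto 0).comp h.tendsto_div_nhds_zero
  rw [Real.sqrt_zero] at h1
  refine h1.congr fun k => ?_
  simp only [Function.comp_apply, div_div_eq_mul_div, div_one]
  rw [Real.sqrt_mul' _ k.cast_nonneg]

theorem tendsto_zero_of_sq_le {V : Type*} [SeminormedAddCommGroup V] {f : ℕ → V} {a : ℕ → ℝ}
    {c C : ℝ} (hc : 0 < c) (ha : Tendsto a atTop (𝓝 0)) (hf : ∀ k, c * ‖f k‖ ^ 2 ≤ C * a k) :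
    Tendsto f atTop (𝓝 0) := by
  have h1 : Tendsto (fun k => ‖f k‖ ^ 2) atTop (𝓝 0) := by
    have h2 := ha.const_mul (C / c)
    rw [mul_zero] at h2
    refine squeeze_zero (fun k => sq_nonneg _) (fun k => ?_) h2
    rw [div_mul_eq_mul_div, le_div_iff₀' hc]
    exact hf k
  rw [tendsto_zero_iff_norm_tendsto_zero]
  have h3 := (Real.continuous_sqrt.tendsto 0).comp h1
  rw [Real.sqrt_zero] at h3
  exact h3.congr fun k => Real.sqrt_sq (norm_nonneg _)

/-- Abel summation: for bounded z the weighted sum of differences is O(k), although the weights sum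
to order k². -/
theorem sum_range_succ_smul_sub {V : Type*} [AddCommGroup V] [Module ℝ V] (z : ℕ → V) (k : ℕ) :
    ∑ j ∈ Finset.range k, ((j : ℝ) + 1) • (z (j + 1) - z j)
      = (k : ℝ) • z k - ∑ j ∈ Finset.range k, z j := by
  induction k with
  | zero => simp
  | succ k ih =>
    rw [Finset.sum_range_succ, Finset.sum_range_succ, ih]
    push_cast
    module

theorem norm_sum_range_succ_smul_sub_le {V : Type*} [NormedAddCommGroup V] [NormedSpace ℝ V]
    {z : ℕ → V} {B : ℝ} (hz : ∀ k, ‖z k‖ ≤ B) (k : ℕ) :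
    ‖∑ j ∈ Finset.range k, ((j : ℝ) + 1) • (z (j + 1) - z j)‖ ≤ k * (2 * B) := by
  rw [sum_range_succ_smul_sub]
  refine (norm_sub_le _ _).trans ?_
  have h1 : ‖∑ j ∈ Finset.range k, z j‖ ≤ k * B := by
    refine (norm_sum_le_of_le _ fun j _ => hz j).trans ?_
    simp
  have h2 : ‖(k : ℝ) • z k‖ ≤ k * B := by
    rw [norm_smul, Real.norm_natCast]
    exact mul_le_mul_of_nonneg_left (hz k) k.cast_nonneg
  linarith

theorem sum_range_natCast_succ (k : ℕ) :
    ∑ j ∈ Finset.range k, ((j : ℝ) + 1) = k * (k + 1) / 2 := by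
  induction k with
  | zero => simp
  | succ k ih => rw [Finset.sum_range_succ, ih]; push_cast; ring

theorem tendsto_weighted_sum_range {V : Type*} [NormedAddCommGroup V] [NormedSpace ℝ V]
    {z : ℕ → V} {z' : V} (hz : Tendsto z atTop (𝓝 z')) :
    Tendsto (fun k : ℕ => (2 / ((k : ℝ) * (k + 1))) •
      ∑ j ∈ Finset.range k, ((j : ℝ) + 1) • z j) atTop (𝓝 z') := by
  have h1 : (fun j : ℕ => ((j : ℝ) + 1) • (z j - z')) =o[atTop] fun j : ℕ => (j : ℝ) + 1 := by
    have h := (isBigO_refl (fun j : ℕ => (j : ℝ) + 1) atTop).smul_isLittleO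
      ((isLittleO_one_iff ℝ).2 (tendsto_sub_nhds_zero_iff.2 hz))
    simpa using h
  have h2 : Tendsto (fun k : ℕ => ∑ j ∈ Finset.range k, ((j : ℝ) + 1)) atTop atTop := by
    refine tendsto_atTop_mono (fun k => ?_) tendsto_natCast_atTop_atTop
    calc (k : ℝ) = ∑ j ∈ Finset.range k, (1 : ℝ) := by simp
      _ ≤ _ := Finset.sum_le_sum fun j _ => by linarith [j.cast_nonneg (α := ℝ)]
  have h3 := h1.sum_range (fun j => by positivity) h2
  rw [← tendsto_sub_nhds_zero_iff]
  have h4 := h3.tendsto_inv_smul_nhds_zero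
  refine h4.congr' ?_
  filter_upwards [eventually_ge_atTop 1] with k hk
  have hk0 : (0 : ℝ) < k := by exact_mod_cast hk
  simp only [smul_sub, Finset.sum_sub_distrib, ← Finset.sum_smul, sum_range_natCast_succ,
    inv_div, smul_smul]
  rw [div_mul_div_cancel₀ (by positivity), div_self two_ne_zero, one_smul]

end SequencesOfReals

/-! ### Convergence of the iterates -/

section PD3OConvergence

local postfix:max "†" => ContinuousLinearMap.adjoint

variable {X U : Type*}
  [NormedAddCommGroup X] [InnerProductSpace ℝ X] [CompleteSpace X]
  [NormedAddCommGroup U] [InnerProductSpace ℝ U] [CompleteSpace U]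

/-- Sequences of PD3O steps under the standing assumptions on the problem and the stepsizes. -/
structure PD3OSequence (F : X → ℝ) (R : X → EReal) (H : U → EReal) (K : X →L[ℝ] U) (L γ η : ℝ)
    (s : ℕ → X) (u : ℕ → U) (x : ℕ → X) (y : ℕ → U) : Prop where
  L_pos : 0 < L
  convexOn : ConvexOn ℝ Set.univ F
  smooth : IsLSmooth L F
  proper_R : ProperClosedConvex R
  proper_H : ProperClosedConvex H
  γ_pos : 0 < γ
  γ_lt : γ < 2 / L
  η_pos : 0 < η
  sq_norm_le : ‖K‖ ^ 2 ≤ η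
  step : ∀ k, PD3OStep F R H K γ η (s k) (u k) (x k) (y k) (s (k + 1)) (u (k + 1))

theorem IsLSmooth.continuous_gradient {f : X → ℝ} {L : ℝ} (hL : 0 < L) (hf : IsLSmooth L f) :
    Continuous (gradient f) := by
  refine (LipschitzWith.of_dist_le_mul (K := ⟨L, hL.le⟩) fun x y => ?_).continuous
  rw [dist_eq_norm, dist_eq_norm]
  exact hf.lipschitz x y

namespace PD3OSequence

variable {F : X → ℝ} {R : X → EReal} {H : U → EReal} {K : X →L[ℝ] U} {γ η L : ℝ}
  {s x : ℕ → X} {u y : ℕ → U} {xs : X} {us : U}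

/-- The distance between two consecutive states. -/
noncomputable abbrev increment (_ : PD3OSequence F R H K L γ η s u x y) (k : ℕ) : ℝ :=
  pd3oForm K η (s (k + 1) - s k) (u (k + 1) - u k)

/-- The distance from the current state to the state of a saddle point `(xs, us)`. -/
noncomputable abbrev excess (_ : PD3OSequence F R H K L γ η s u x y) (xs : X) (us : U) (k : ℕ) : ℝ :=
  pd3oForm K η (s k - ((1 / γ) • xs - gradient F xs - K† us)) (u k - us)

/-- The sum of the three monotonicity terms between the step `k` and a saddle point. -/
noncomputable abbrev monotoneGap (_ : PD3OSequence F R H K L γ η s u x y) (xs : X) (us : U) (k : ℕ) : ℝ :=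
  inner ℝ (gradient F (x k) - gradient F xs) (x k - xs)
    + inner ℝ ((s k - (1 / γ) • x k) - ((1 / γ) • xs - gradient F xs - K† us - (1 / γ) • xs))
      (x k - xs)
    + inner ℝ (u (k + 1) - us) (y k - K xs)

variable (h : PD3OSequence F R H K L γ η s u x y)
include h

theorem increment_nonneg (k : ℕ) : 0 ≤ h.increment k := pd3oForm_nonneg h.sq_norm_le _ _

theorem excess_nonneg (xs : X) (us : U) (k : ℕ) : 0 ≤ h.excess xs us k :=
  pd3oForm_nonneg h.sq_norm_le _ _

theorem antitone_increment : Antitone h.increment :=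
  antitone_nat_of_succ_le fun k => PD3OStep.pd3oForm_le h.L_pos h.convexOn h.smooth h.proper_R
    h.proper_H h.γ_pos h.γ_lt h.sq_norm_le (h.step (k + 1)) (h.step k)

theorem antitone_excess (hz : IsSaddlePoint F R H K xs us) : Antitone (h.excess xs us) :=
  antitone_nat_of_succ_le fun k => PD3OStep.pd3oForm_le h.L_pos h.convexOn h.smooth h.proper_R
    h.proper_H h.γ_pos h.γ_lt h.sq_norm_le (h.step k) (hz.pd3oStep γ η)

theorem inner_dual_nonneg (hz : IsSaddlePoint F R H K xs us) (k : ℕ) :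
    0 ≤ (inner ℝ (u (k + 1) - us) (y k - K xs) : ℝ) :=
  h.proper_H.inner_subdiff_nonneg (h.step k).mem_H hz.mem_H

theorem summable (hz : IsSaddlePoint F R H K xs us) :
    Summable h.increment ∧ Summable (fun k => ‖gradient F (x k) - gradient F xs‖ ^ 2) ∧
      Summable fun k => (inner ℝ (u (k + 1) - us) (y k - K xs) : ℝ) := by
  obtain ⟨c, hc, hle⟩ := PD3OStep.pd3oForm_add_le (H := H) h.L_pos h.convexOn h.smooth h.proper_R
    h.γ_pos h.γ_lt h.sq_norm_le
  have h1 : ∀ k, c * h.increment k + c * ‖gradient F (x k) - gradient F xs‖ ^ 2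
      + 2 / γ * inner ℝ (u (k + 1) - us) (y k - K xs)
      ≤ h.excess xs us k - h.excess xs us (k + 1) := fun k => by
    have := hle (h.step k) (hz.pd3oStep γ η)
    rw [sub_self, sub_self, sub_zero, sub_zero] at this
    linarith
  have i1 : ∀ k, 0 ≤ c * h.increment k := fun k => mul_nonneg hc.le (h.increment_nonneg k)
  have i2 : ∀ k, 0 ≤ c * ‖gradient F (x k) - gradient F xs‖ ^ 2 := fun k => by positivity
  have hγ : 0 < 2 / γ := div_pos two_pos h.γ_pos
  have i3 : ∀ k, 0 ≤ 2 / γ * inner ℝ (u (k + 1) - us) (y k - K xs) := fun k =>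
    mul_nonneg hγ.le (h.inner_dual_nonneg hz k)
  have hb := h.excess_nonneg xs us
  refine ⟨(summable_mul_left_iff hc.ne').1 ?_, (summable_mul_left_iff hc.ne').1 ?_,
    (summable_mul_left_iff hγ.ne').1 ?_⟩
  · exact summable_of_le_sub_succ i1 hb fun k => by linarith [h1 k, i2 k, i3 k]
  · exact summable_of_le_sub_succ i2 hb fun k => by linarith [h1 k, i1 k, i3 k]
  · exact summable_of_le_sub_succ i3 hb fun k => by linarith [h1 k, i1 k, i2 k]

theorem sq_norm_sub_map_le (k : ℕ) :
    ‖y k - K (x k)‖ ^ 2 ≤ γ ^ 2 * (2 * η) * h.increment k :=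
  (h.step k).sq_norm_sub_map_le h.sq_norm_le

theorem summable_sq_norm_sub_map (hz : IsSaddlePoint F R H K xs us) :
    Summable fun k => ‖y k - K (x k)‖ ^ 2 :=
  Summable.of_nonneg_of_le (fun _ => sq_nonneg _) h.sq_norm_sub_map_le
    ((h.summable hz).1.mul_left _)

theorem sq_norm_primal_sub_le (hz : IsSaddlePoint F R H K xs us) (k : ℕ) :
    ‖x k - xs‖ ^ 2 ≤ γ ^ 2 * h.excess xs us k := by
  have h1 := PD3OStep.norm_sub_le h.γ_pos h.proper_R (h.step k) (hz.pd3oStep γ η)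
  calc ‖x k - xs‖ ^ 2 ≤ (γ * ‖s k - ((1 / γ) • xs - gradient F xs - K† us)‖) ^ 2 := by gcongr
    _ ≤ _ := by
      rw [mul_pow]
      gcongr
      exact sq_norm_le_pd3oForm h.sq_norm_le _ _

theorem sq_norm_dual_sub_le (hz : IsSaddlePoint F R H K xs us) (k : ℕ) :
    η * ‖u (k + 1) - us‖ ^ 2 ≤ (1 + (2 + L * γ) ^ 2) * h.excess xs us k :=
  PD3OStep.sq_norm_sub_dual_le h.L_pos h.convexOn h.smooth h.proper_R
    h.proper_H h.γ_pos h.γ_lt h.sq_norm_le (h.step k) (hz.pd3oStep γ η)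

theorem tendsto_of_excess (hz : IsSaddlePoint F R H K xs us)
    (he : Tendsto (h.excess xs us) atTop (𝓝 0)) :
    Tendsto x atTop (𝓝 xs) ∧ Tendsto u atTop (𝓝 us) := by
  constructor
  · exact tendsto_sub_nhds_zero_iff.1 <| tendsto_zero_of_sq_le one_pos he fun k => by
      rw [one_mul]; exact h.sq_norm_primal_sub_le hz k
  · rw [← tendsto_add_atTop_iff_nat 1]
    exact tendsto_sub_nhds_zero_iff.1 <| tendsto_zero_of_sq_le h.η_pos he
      (h.sq_norm_dual_sub_le hz)

theorem tendsto_sub_map (hz : IsSaddlePoint F R H K xs us) :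
    Tendsto (fun k => y k - K (x k)) atTop (𝓝 0) :=
  tendsto_zero_of_sq_le one_pos (h.summable hz).1.tendsto_atTop_zero fun k => by
    rw [one_mul]; exact h.sq_norm_sub_map_le k

theorem tendsto_state (hx : Tendsto x atTop (𝓝 xs)) (hu : Tendsto u atTop (𝓝 us)) :
    Tendsto s atTop (𝓝 ((1 / γ) • xs - gradient F xs - K† us)) := by
  rw [← tendsto_add_atTop_iff_nat 1]
  simp only [(h.step _).s_eq]
  exact ((hx.const_smul _).sub (((h.smooth.continuous_gradient h.L_pos).tendsto _).comp hx)).sub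
    (((K†).continuous.tendsto _).comp (hu.comp (tendsto_add_atTop_nat 1)))

/-- Opial-type argument: a cluster point is a saddle point, and the nonincreasing distance to it
vanishes along a subsequence. -/
theorem exists_tendsto [FiniteDimensional ℝ X] [FiniteDimensional ℝ U]
    (hz : IsSaddlePoint F R H K xs us) :
    ∃ (x' : X) (u' : U), IsSaddlePoint F R H K x' u' ∧ Tendsto x atTop (𝓝 x') ∧
      Tendsto u atTop (𝓝 u') := by
  have := FiniteDimensional.proper_real X
  have := FiniteDimensional.proper_real U
  have hinc := (h.summable hz).1.tendsto_atTop_zero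
  have hsdiff : Tendsto (fun k => s (k + 1) - s k) atTop (𝓝 0) :=
    tendsto_zero_of_sq_le one_pos hinc fun k => by
      rw [one_mul, one_mul]; exact sq_norm_le_pd3oForm h.sq_norm_le _ _
  have hxdiff : Tendsto (fun k => x (k + 1) - x k) atTop (𝓝 0) := by
    refine tendsto_zero_of_sq_le one_pos hinc (C := γ ^ 2) fun k => ?_
    have h1 := PD3OStep.norm_sub_le h.γ_pos h.proper_R (h.step (k + 1)) (h.step k)
    rw [one_mul]
    calc ‖x (k + 1) - x k‖ ^ 2 ≤ (γ * ‖s (k + 1) - s k‖) ^ 2 := by gcongr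
      _ ≤ _ := by
        rw [mul_pow]
        gcongr
        exact sq_norm_le_pd3oForm h.sq_norm_le _ _
  have hbx : ∀ k, x k ∈ Metric.closedBall xs √(γ ^ 2 * h.excess xs us 0) := fun k => by
    rw [mem_closedBall_iff_norm]
    refine Real.le_sqrt_of_sq_le ((h.sq_norm_primal_sub_le hz k).trans ?_)
    gcongr
    exact h.antitone_excess hz k.zero_le
  have hbu : ∀ k, u (k + 1) ∈
      Metric.closedBall us √((1 + (2 + L * γ) ^ 2) * h.excess xs us 0 / η) := fun k => by
    rw [mem_closedBall_iff_norm]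
    refine Real.le_sqrt_of_sq_le ?_
    rw [le_div_iff₀' h.η_pos]
    refine (h.sq_norm_dual_sub_le hz k).trans ?_
    gcongr
    exact h.antitone_excess hz k.zero_le
  -- The dual variable is taken at k + 1, where the distance controls it; s at k + 1 is then a
  -- continuous function of this pair.
  obtain ⟨⟨x', u'⟩, -, φ, hφ, hlim⟩ :=
    ((isCompact_closedBall xs _).prod (isCompact_closedBall us _)).tendsto_subseq
      (x := fun k => (x k, u (k + 1))) fun k => Set.mk_mem_prod (hbx k) (hbu k)
  have hx' : Tendsto (x ∘ φ) atTop (𝓝 x') := (continuous_fst.tendsto _).comp hlim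
  have hu' : Tendsto (fun k => u (φ k + 1)) atTop (𝓝 u') := (continuous_snd.tendsto _).comp hlim
  have hs' : Tendsto (fun k => s (φ k + 1)) atTop
      (𝓝 ((1 / γ) • x' - gradient F x' - K† u')) := by
    simp only [(h.step _).s_eq]
    exact ((hx'.const_smul _).sub
      (((h.smooth.continuous_gradient h.L_pos).tendsto _).comp hx')).sub
      (((K†).continuous.tendsto _).comp hu')
  have hx'' : Tendsto (fun k => x (φ k + 1)) atTop (𝓝 x') := by
    have := (hxdiff.comp hφ.tendsto_atTop).add hx'
    rw [zero_add] at this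
    exact this.congr fun k => sub_add_cancel _ _
  have hsad : IsSaddlePoint F R H K x' u' := by
    constructor
    · refine h.proper_R.mem_subdiff_of_tendsto (fun k => (h.step (φ k + 1)).mem_R) hx'' ?_
      have := hs'.sub (hx''.const_smul (1 / γ))
      convert this using 2
      abel
    · refine h.proper_H.mem_subdiff_of_tendsto (fun k => (h.step (φ k)).mem_H) ?_ hu'
      have := ((h.tendsto_sub_map hz).comp hφ.tendsto_atTop).add ((K.continuous.tendsto _).comp hx')
      rw [zero_add] at this
      exact this.congr fun k => sub_add_cancel _ _
  refine ⟨x', u', hsad, h.tendsto_of_excess hsad ?_⟩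
  have hsub : Tendsto (fun k => h.excess x' u' (φ k + 1)) atTop (𝓝 0) := by
    have hcont : Continuous fun p : X × U => pd3oForm K η p.1 p.2 := by
      unfold pd3oForm; fun_prop
    have h1 := (hcont.tendsto (0, 0)).comp
      ((tendsto_sub_nhds_zero_iff.2 hs').prodMk_nhds (tendsto_sub_nhds_zero_iff.2 hu'))
    have h2 : pd3oForm K η (0 : X) (0 : U) = 0 := by simp [pd3oForm]
    rw [h2] at h1
    exact h1
  have hbdd : BddBelow (Set.range (h.excess x' u')) :=
    ⟨0, by rintro _ ⟨k, rfl⟩; exact h.excess_nonneg _ _ _⟩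
  have hinf := tendsto_atTop_ciInf (h.antitone_excess hsad) hbdd
  have hφ1 : Tendsto (fun k => φ k + 1) atTop atTop :=
    tendsto_atTop_mono (fun k => Nat.le_succ _) hφ.tendsto_atTop
  rwa [tendsto_nhds_unique (hinf.comp hφ1) hsub] at hinf

end PD3OSequence

/-- The point y is γη times the difference between the argument of the conjugate prox and its value.
The pair w, v only supplies the subgradient needed for Moreau's decomposition. -/
theorem IsPD3O.pd3oStep [FiniteDimensional ℝ X] [FiniteDimensional ℝ U]
    {F : X → ℝ} {R : X → EReal} {H : U → EReal} {K : X →L[ℝ] U} {γ η : ℝ}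
    {x q : ℕ → X} {u : ℕ → U} (h : IsPD3O F R H K (fun _ => γ) η x q u)
    (hR : ProperClosedConvex R) (hH : ProperClosedConvex H) (hγ : 0 < γ) (hη : 0 < η)
    {w v : U} (hv : v ∈ subdiff H w) (k : ℕ) :
    PD3OStep F R H K γ η (q k - K† (u k)) (u k) (x (k + 1))
      ((γ * η) • (u k - u (k + 1)) + K (x (k + 1) + γ • (q (k + 1) - q k)))
      (q (k + 1) - K† (u (k + 1))) (u (k + 1)) where
  mem_R := by
    have := hR.mem_subdiff_of_isProx hγ (h.x_step k)
    rwa [smul_sub, smul_smul, one_div_mul_cancel hγ.ne', one_smul] at this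
  mem_H := by
    have := hH.mem_subdiff_of_isProx_conjugate hv (by positivity) (h.u_step k)
    convert this using 1
    simp only [map_add, map_sub, map_smul, smul_add, smul_sub, smul_smul, one_div_one_div]
    have e1 : γ * η * (1 / η) = γ := by field_simp
    rw [← mul_assoc, e1, mul_one_div_cancel hγ.ne']
    congr 1
    module
  s_eq := by rw [h.q_step]
  y_eq := by
    simp only [map_sub, map_add, map_smul]
    module

end PD3OConvergence

/-! ### Convergence rates of the objective -/

section Rates

local postfix:max "†" => ContinuousLinearMap.adjoint

/-- Continuity at z makes G finite nearby, and a finite convex function on an open set in finite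
dimension is locally Lipschitz. -/
theorem ProperClosedConvex.exists_lipschitz_nhds {E : Type*} [NormedAddCommGroup E]
    [InnerProductSpace ℝ E] [FiniteDimensional ℝ E] {G : E → EReal} (hG : ProperClosedConvex G)
    {z : E} {ρ : ℝ} (hρ : 0 < ρ) (hcont : ContinuousOn G (Metric.ball z ρ)) (hz : G z ≠ ⊤) :
    ∃ M : ℝ, 0 ≤ M ∧ ∃ t ∈ 𝓝 z, (∀ a ∈ t, G a ≠ ⊤) ∧
      ∀ a ∈ t, ∀ b ∈ t, (G a).toReal - (G b).toReal ≤ M * ‖a - b‖ := by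
  have hat : ContinuousAt G z := hcont.continuousAt (Metric.ball_mem_nhds z hρ)
  have hfin : ∀ᶠ a in 𝓝 z, G a ≠ ⊤ := hat.eventually_ne hz
  obtain ⟨ε, hε, hball⟩ := Metric.eventually_nhds_iff_ball.1 hfin
  have hconv : ConvexOn ℝ (Metric.ball z ε) fun a => (G a).toReal :=
    hG.convexOn_toReal.subset (fun a ha => hball a ha) (convex_ball z ε)
  obtain ⟨M, t, ht, hlip⟩ := hconv.locallyLipschitzOn Metric.isOpen_ball
    (Metric.mem_ball_self hε)
  rw [Metric.isOpen_ball.nhdsWithin_eq (Metric.mem_ball_self hε)] at ht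
  refine ⟨M, M.coe_nonneg, t ∩ Metric.ball z ε,
    inter_mem ht (Metric.ball_mem_nhds z hε), fun a ha => hball a ha.2, fun a ha b hb => ?_⟩
  have := hlip.dist_le_mul a ha.1 b hb.1
  rw [dist_eq_norm a b, Real.dist_eq] at this
  exact (le_abs_self _).trans this

theorem primalObj_eq_coe {X U : Type*} [NormedAddCommGroup X] [InnerProductSpace ℝ X]
    [NormedAddCommGroup U] [InnerProductSpace ℝ U]
    {F : X → ℝ} {R : X → EReal} {H : U → EReal} {K : X →L[ℝ] U} (hR : ProperClosedConvex R) (hH : ProperClosedConvex H) {x : X}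
    (hx : R x ≠ ⊤) (hKx : H (K x) ≠ ⊤) :
    primalObj F R H K x = ((F x + (R x).toReal + (H (K x)).toReal : ℝ) : EReal) := by
  obtain ⟨r, hr⟩ := EReal.exists_coe_eq hx (hR.ne_bot x)
  obtain ⟨t, ht⟩ := EReal.exists_coe_eq hKx (hH.ne_bot _)
  rw [primalObj, hr, ht, EReal.toReal_coe, EReal.toReal_coe]
  norm_cast

theorem IsSolution.toReal_le {X : Type*} {f : X → EReal} {z w : X} (hz : IsSolution f z) (hw : f w ≠ ⊤) :
    (f z).toReal ≤ (f w).toReal := by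
  obtain ⟨r, hr⟩ := hz.1
  exact EReal.toReal_le_toReal (hz.2 w) (by rw [hr]; exact EReal.coe_ne_bot r) hw

variable {X U : Type*}
  [NormedAddCommGroup X] [InnerProductSpace ℝ X] [CompleteSpace X]
  [NormedAddCommGroup U] [InnerProductSpace ℝ U] [CompleteSpace U]
  {F : X → ℝ} {R : X → EReal} {H : U → EReal} {K : X →L[ℝ] U} {γ η L : ℝ}
  {s x : ℕ → X} {u y : ℕ → U} {xs : X} {us : U}

namespace PD3OSequence

variable (h : PD3OSequence F R H K L γ η s u x y)
include h

theorem R_ne_top (k : ℕ) : R (x k) ≠ ⊤ := h.proper_R.ne_top_of_mem_subdiff (h.step k).mem_R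

theorem H_ne_top (k : ℕ) : H (y k) ≠ ⊤ := h.proper_H.ne_top_of_mem_subdiff (h.step k).mem_H

theorem isSolution (hz : IsSaddlePoint F R H K xs us) : IsSolution (primalObj F R H K) xs :=
  hz.isSolution_primalObj h.proper_R h.proper_H h.convexOn h.smooth.differentiable

theorem toReal_saddle (hz : IsSaddlePoint F R H K xs us) :
    (primalObj F R H K xs).toReal = F xs + (R xs).toReal + (H (K xs)).toReal := by
  rw [primalObj_eq_coe h.proper_R h.proper_H (h.proper_R.ne_top_of_mem_subdiff hz.mem_R)
    (h.proper_H.ne_top_of_mem_subdiff hz.mem_H), EReal.toReal_coe]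

/-- Sum of the three subgradient inequalities at the iterate. H is evaluated at y, where u' is a
subgradient, and not at Kx; the last term pays for the mismatch. -/
theorem value_sub_le (hz : IsSaddlePoint F R H K xs us) (k : ℕ) :
    F (x k) + (R (x k)).toReal + (H (y k)).toReal - (primalObj F R H K xs).toReal
      ≤ h.monotoneGap xs us k + inner ℝ us (y k - K (x k)) := by
  rw [h.toReal_saddle hz]
  have h1 := h.convexOn.add_inner_gradient_le h.smooth.differentiable (x k) xs
  have h2 := h.proper_R.toReal_sub_le (h.step k).mem_R
    (h.proper_R.ne_top_of_mem_subdiff hz.mem_R)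
  have h3 := h.proper_H.toReal_sub_le (h.step k).mem_H
    (h.proper_H.ne_top_of_mem_subdiff hz.mem_H)
  rw [← neg_sub (x k) xs, inner_neg_right] at h1
  have e1 : (1 / γ) • xs - gradient F xs - K† us - (1 / γ) • xs = -(gradient F xs) - K† us := by
    abel
  have e2 : (inner ℝ us (y k - K (x k)) : ℝ)
      = inner ℝ us (y k - K xs) - inner ℝ (K† us) (x k - xs) := by
    rw [ContinuousLinearMap.adjoint_inner_left, ← inner_sub_right, map_sub]
    congr 1; abel
  rw [monotoneGap, e1, e2]
  simp only [inner_sub_left _ _ (x k - xs), inner_sub_left _ _ (y k - K xs), inner_neg_left]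
    at h2 ⊢
  linarith

/-- By the formula for s', the bound of `value_sub_le` is linear in the increment s' - s and the
residual y - Kx. -/
theorem monotoneGap_add_eq (xs : X) (us : U) (k : ℕ) :
    h.monotoneGap xs us k + inner ℝ us (y k - K (x k))
      = -inner ℝ (s (k + 1) - s k) (x k - xs) + inner ℝ (u (k + 1)) (y k - K (x k)) := by
  have e1 : (1 / γ) • xs - gradient F xs - K† us - (1 / γ) • xs = -(gradient F xs) - K† us := by
    abel
  have e2 : ∀ v : U, (inner ℝ v (y k - K (x k)) : ℝ)
      = inner ℝ v (y k - K xs) - inner ℝ (K† v) (x k - xs) := fun v => by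
    rw [ContinuousLinearMap.adjoint_inner_left, ← inner_sub_right, map_sub]
    congr 1; abel
  rw [monotoneGap, e1, e2, e2, (h.step k).s_eq]
  simp only [inner_sub_left _ _ (x k - xs), inner_sub_left _ _ (y k - K xs), inner_neg_left]
  ring

theorem monotoneGap_le (hz : IsSaddlePoint F R H K xs us) (k : ℕ) :
    h.monotoneGap xs us k ≤ γ / 2 * (h.excess xs us k - h.excess xs us (k + 1)
      + ‖gradient F (x k) - gradient F xs‖ ^ 2) :=
  PD3OStep.inner_add_le h.γ_pos h.sq_norm_le (h.step k) (hz.pd3oStep γ η)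

theorem summable_excess_sub (hz : IsSaddlePoint F R H K xs us) :
    Summable fun k => h.excess xs us k - h.excess xs us (k + 1) :=
  summable_of_le_sub_succ
    (fun k => sub_nonneg.2 (h.antitone_excess hz k.le_succ))
    (h.excess_nonneg xs us) fun _ => le_rfl

theorem tendsto_y (hz : IsSaddlePoint F R H K xs us) (hx : Tendsto x atTop (𝓝 xs)) :
    Tendsto y atTop (𝓝 (K xs)) := by
  have := (h.tendsto_sub_map hz).add ((K.continuous.tendsto _).comp hx)
  rw [zero_add] at this
  exact this.congr fun k => sub_add_cancel _ _

theorem exists_abs_value_sub_le [FiniteDimensional ℝ U] (hz : IsSaddlePoint F R H K xs us)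
    (hx : Tendsto x atTop (𝓝 xs)) (hu : Tendsto u atTop (𝓝 us)) {ρ : ℝ} (hρ : 0 < ρ)
    (hcont : ContinuousOn H (Metric.ball (K xs) ρ)) :
    (∀ᶠ k in atTop, primalObj F R H K (x k) ≠ ⊤) ∧
      ∃ C : ℝ, ∀ᶠ k in atTop, |(primalObj F R H K (x k)).toReal - (primalObj F R H K xs).toReal|
        ≤ C * √(h.increment k) := by
  obtain ⟨M, hM, t, ht, htop, hlip⟩ := h.proper_H.exists_lipschitz_nhds hρ hcont
    (h.proper_H.ne_top_of_mem_subdiff hz.mem_H)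
  have ev1 : ∀ᶠ k in atTop, K (x k) ∈ t := ((K.continuous.tendsto _).comp hx).eventually_mem ht
  have ev2 : ∀ᶠ k in atTop, y k ∈ t := (h.tendsto_y hz hx).eventually_mem ht
  have ev3 : ∀ᶠ k in atTop, ‖x k - xs‖ ≤ 1 := by
    have := (tendsto_sub_nhds_zero_iff.2 hx).norm
    rw [norm_zero] at this
    exact this.eventually_le_const one_pos
  have ev4 : ∀ᶠ k in atTop, ‖u (k + 1)‖ ≤ ‖us‖ + 1 :=
    (hu.comp (tendsto_add_atTop_nat 1)).norm.eventually_le_const (lt_add_one _)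
  have hval : ∀ k, K (x k) ∈ t → primalObj F R H K (x k)
      = ((F (x k) + (R (x k)).toReal + (H (K (x k))).toReal : ℝ) : EReal) := fun k hk =>
    primalObj_eq_coe h.proper_R h.proper_H (h.R_ne_top k) (htop _ hk)
  -- In the constant, 1 bounds ‖x - x*‖, ‖u*‖ + 1 bounds ‖u'‖, M is the Lipschitz constant of H, and
  -- the square root comes from the residual estimate.
  refine ⟨ev1.mono fun k hk => by rw [hval k hk]; exact EReal.coe_ne_top _,
    1 + (‖us‖ + 1 + M) * √(γ ^ 2 * (2 * η)), ?_⟩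
  filter_upwards [ev1, ev2, ev3, ev4] with k h1 h2 h3 h4
  have hne : primalObj F R H K (x k) ≠ ⊤ := by rw [hval k h1]; exact EReal.coe_ne_top _
  have hge := (h.isSolution hz).toReal_le hne
  rw [abs_of_nonneg (sub_nonneg.2 hge), hval k h1, EReal.toReal_coe]
  have g1 := h.value_sub_le hz k
  rw [h.monotoneGap_add_eq] at g1
  have g2 := hlip _ h1 _ h2
  rw [norm_sub_rev] at g2
  have g3 := neg_le_of_abs_le (abs_real_inner_le_norm (s (k + 1) - s k) (x k - xs))
  have g4 := real_inner_le_norm (u (k + 1)) (y k - K (x k))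
  have g5 : ‖s (k + 1) - s k‖ ≤ √(h.increment k) :=
    Real.le_sqrt_of_sq_le (sq_norm_le_pd3oForm h.sq_norm_le _ _)
  have g6 : ‖y k - K (x k)‖ ≤ √(γ ^ 2 * (2 * η)) * √(h.increment k) := by
    rw [← Real.sqrt_mul (by have := h.η_pos; positivity)]
    exact Real.le_sqrt_of_sq_le (h.sq_norm_sub_map_le k)
  have g7 : ‖s (k + 1) - s k‖ * ‖x k - xs‖ ≤ √(h.increment k) * 1 := by gcongr
  have g8 : ‖u (k + 1)‖ * ‖y k - K (x k)‖
      ≤ (‖us‖ + 1) * (√(γ ^ 2 * (2 * η)) * √(h.increment k)) := by gcongr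
  have g9 := mul_le_mul_of_nonneg_left g6 hM
  linarith

/-- Convexity of f at Kx turns the mismatch into ⟨u* - ∇f(Kx), y - Kx⟩. Splitting at u' = ∇f(y)
leaves products of square-summable terms, since Baillon–Haddad bounds ‖u' - u*‖² by ℓ times the
summable dual product. -/
theorem summable_value_sub {ℓ : ℝ} {f : U → ℝ} (hℓ : 0 < ℓ) (hf : IsLSmooth ℓ f)
    (hHf : ∀ v, H v = (f v : EReal)) (hz : IsSaddlePoint F R H K xs us) :
    Summable fun k => (primalObj F R H K (x k)).toReal - (primalObj F R H K xs).toReal := by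
  have htop : ∀ v, H v ≠ ⊤ := fun v => by rw [hHf]; exact EReal.coe_ne_top _
  have hfc : ConvexOn ℝ Set.univ f := by
    have := h.proper_H.convexOn_toReal
    simpa [hHf] using this
  have hval : ∀ k, primalObj F R H K (x k)
      = ((F (x k) + (R (x k)).toReal + (H (K (x k))).toReal : ℝ) : EReal) := fun k =>
    primalObj_eq_coe h.proper_R h.proper_H (h.R_ne_top k) (htop _)
  obtain ⟨-, hsg, hsi⟩ := h.summable hz
  have hsum := (((h.summable_excess_sub hz).add hsg).mul_left (γ / 2)).add
    (((h.summable_sq_norm_sub_map hz).mul_left (ℓ + 1)).add (hsi.mul_left ℓ))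
  refine Summable.of_nonneg_of_le (fun k => ?_) (fun k => ?_) hsum
  · exact sub_nonneg.2 ((h.isSolution hz).toReal_le (by rw [hval]; exact EReal.coe_ne_top _))
  · rw [hval, EReal.toReal_coe]
    have g1 := h.value_sub_le hz k
    have g2 := h.monotoneGap_le hz k
    have hu' : gradient f (y k) = u (k + 1) :=
      gradient_eq_of_mem_subdiff hf.differentiable hHf (h.step k).mem_H
    have hus : gradient f (K xs) = us :=
      gradient_eq_of_mem_subdiff hf.differentiable hHf hz.mem_H
    have g3 := hf.sq_gradient_sub_le_inner hℓ hfc (y k) (K xs)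
    rw [hu', hus, one_div, inv_mul_le_iff₀ hℓ] at g3
    have g4 := hfc.add_inner_gradient_le hf.differentiable (K (x k)) (y k)
    have g5 := hf.lipschitz (y k) (K (x k))
    rw [hu'] at g5
    have g6 := real_inner_le_norm (u (k + 1) - gradient f (K (x k))) (y k - K (x k))
    have g7 := mul_le_mul_of_nonneg_right g5 (norm_nonneg (y k - K (x k)))
    have g8 := neg_le_of_abs_le (abs_real_inner_le_norm (u (k + 1) - us) (y k - K (x k)))
    have g9 := two_mul_le_add_sq ‖u (k + 1) - us‖ ‖y k - K (x k)‖
    rw [inner_sub_left] at g6 g8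
    have e1 : (H (K (x k))).toReal = f (K (x k)) := by rw [hHf, EReal.toReal_coe]
    have e2 : (H (y k)).toReal = f (y k) := by rw [hHf, EReal.toReal_coe]
    rw [e1]
    rw [e2] at g1
    nlinarith [sq_nonneg ‖u (k + 1) - us‖, sq_nonneg ‖y k - K (x k)‖]

/-- The residual y - Kx is the increment of a linear function of the state, bounded because the
state converges; weighted sums of it can thus be summed by parts. -/
theorem exists_norm_state_le (hx : Tendsto x atTop (𝓝 xs)) (hu : Tendsto u atTop (𝓝 us)) :
    ∃ z : ℕ → U, (∀ k, y k - K (x k) = z (k + 1) - z k) ∧ ∃ B, ∀ k, ‖z k‖ ≤ B := by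
  refine ⟨fun k => γ • (K (s k) - (η • u k - K (K† (u k)))), fun k => ?_, ?_⟩
  · rw [(h.step k).y_eq, add_sub_cancel_left]
    simp only [map_sub]
    module
  · have hs := h.tendsto_state hx hu
    have ht : Tendsto (fun k => γ • (K (s k) - (η • u k - K (K† (u k))))) atTop
        (𝓝 (γ • (K ((1 / γ) • xs - gradient F xs - K† us) - (η • us - K (K† us))))) := by
      have hc : Continuous fun p : X × U => γ • (K p.1 - (η • p.2 - K (K† p.2))) := by fun_prop
      exact (hc.tendsto (_, _)).comp (hs.prodMk_nhds hu)
    obtain ⟨B, hB⟩ := ht.norm.bddAbove_range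
    exact ⟨B, fun k => hB ⟨k, rfl⟩⟩

/-- Jensen's inequality is applied with H at the average of the y's; the Lipschitz bound then moves
it to K of the averaged x, at distance O(1/k). -/
theorem isBigO_ergodic_value [FiniteDimensional ℝ U] (hz : IsSaddlePoint F R H K xs us)
    (hx : Tendsto x atTop (𝓝 xs)) (hu : Tendsto u atTop (𝓝 us)) {ρ : ℝ} (hρ : 0 < ρ)
    (hcont : ContinuousOn H (Metric.ball (K xs) ρ)) {xbar : ℕ → X}
    (hxbar : ∀ k : ℕ, xbar k = (2 / ((k : ℝ) * (k + 1))) •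
      ∑ j ∈ Finset.range k, ((j : ℝ) + 1) • x j) :
    (∀ᶠ k in atTop, primalObj F R H K (xbar k) ≠ ⊤) ∧
      (fun k => (primalObj F R H K (xbar k)).toReal - (primalObj F R H K xs).toReal)
        =O[atTop] fun k : ℕ => 1 / (k : ℝ) := by
  obtain ⟨M, hM, t, ht, htop, hlip⟩ := h.proper_H.exists_lipschitz_nhds hρ hcont
    (h.proper_H.ne_top_of_mem_subdiff hz.mem_H)
  obtain ⟨z, hyz, B, hB⟩ := h.exists_norm_state_le hx hu
  let w : ℕ → ℝ := fun k => 2 / ((k : ℝ) * (k + 1))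
  let ybar : ℕ → U := fun k => w k • ∑ j ∈ Finset.range k, ((j : ℝ) + 1) • y j
  have hxlim : Tendsto xbar atTop (𝓝 xs) := by
    rw [funext hxbar]; exact tendsto_weighted_sum_range hx
  have hylim : Tendsto ybar atTop (𝓝 (K xs)) := tendsto_weighted_sum_range (h.tendsto_y hz hx)
  have ev1 : ∀ᶠ k in atTop, K (xbar k) ∈ t :=
    ((K.continuous.tendsto _).comp hxlim).eventually_mem ht
  have ev2 : ∀ᶠ k in atTop, ybar k ∈ t := hylim.eventually_mem ht
  have hR : ∀ k, 1 ≤ k → R (xbar k) ≠ ⊤ ∧ F (xbar k) + (R (xbar k)).toReal + (H (ybar k)).toReal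
      ≤ w k * ∑ j ∈ Finset.range k, ((j : ℝ) + 1) *
        (F (x j) + (R (x j)).toReal + (H (y j)).toReal) := by
    intro k hk
    have hk0 : (0 : ℝ) < k := by exact_mod_cast hk
    have w0 : ∀ j ∈ Finset.range k, 0 ≤ w k * ((j : ℝ) + 1) := fun j _ => by positivity
    have w1 : ∑ j ∈ Finset.range k, w k * ((j : ℝ) + 1) = 1 := by
      rw [← Finset.mul_sum, sum_range_natCast_succ]
      simp only [w]
      field_simp
    have ex : xbar k = ∑ j ∈ Finset.range k, (w k * ((j : ℝ) + 1)) • x j := by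
      simp only [hxbar, Finset.smul_sum, smul_smul, w]
    have ey : ybar k = ∑ j ∈ Finset.range k, (w k * ((j : ℝ) + 1)) • y j := by
      simp only [ybar, Finset.smul_sum, smul_smul]
    have c1 := h.convexOn.map_sum_le w0 w1 (p := x) fun j _ => Set.mem_univ _
    have c2 := h.proper_R.convexOn_toReal.map_sum_le w0 w1 (p := x) fun j _ => h.R_ne_top j
    have c3 := h.proper_H.convexOn_toReal.map_sum_le w0 w1 (p := y) fun j _ => h.H_ne_top j
    have c4 := h.proper_R.convexOn_toReal.1.sum_mem w0 w1 (z := x) fun j _ => h.R_ne_top j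
    rw [← ex] at c1 c2 c4
    rw [← ey] at c3
    refine ⟨c4, (add_le_add (add_le_add c1 c2) c3).trans (le_of_eq ?_)⟩
    simp only [smul_eq_mul, ← Finset.sum_add_distrib, Finset.mul_sum]
    exact Finset.sum_congr rfl fun j _ => by ring
  have hval : ∀ k, 1 ≤ k → K (xbar k) ∈ t → primalObj F R H K (xbar k)
      = ((F (xbar k) + (R (xbar k)).toReal + (H (K (xbar k))).toReal : ℝ) : EReal) :=
    fun k hk hkt => primalObj_eq_coe h.proper_R h.proper_H (hR k hk).1 (htop _ hkt)
  have hne : ∀ k, 1 ≤ k → K (xbar k) ∈ t → primalObj F R H K (xbar k) ≠ ⊤ := fun k hk hkt => by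
    rw [hval k hk hkt]; exact EReal.coe_ne_top _
  refine ⟨?_, ?_⟩
  · filter_upwards [ev1, eventually_ge_atTop 1] with k h1 hk using hne k hk h1
  set V := h.excess xs us
  set S := ∑' k, ‖gradient F (x k) - gradient F xs‖ ^ 2
  have hyx : ∀ k, ybar k - K (xbar k)
      = w k • ∑ j ∈ Finset.range k, ((j : ℝ) + 1) • (z (j + 1) - z j) := fun k => by
    simp only [hxbar, ybar, w, map_smul, map_sum, ← smul_sub, ← Finset.sum_sub_distrib, ← hyz]
  -- The terms are the Abel sum of the distances with the gradient series, the Abel sum of residuals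
  -- against u*, and the Lipschitz correction; the factor 2 comes from w k * k ≤ 2/k.
  refine IsBigO.of_bound (2 * (γ / 2 * (2 * V 0 + S) + ‖us‖ * (2 * B) + M * (2 * B))) ?_
  filter_upwards [ev1, ev2, eventually_ge_atTop 1] with k h1 h2 hk
  have hk0 : (0 : ℝ) < k := by exact_mod_cast hk
  have hw0 : 0 ≤ w k := by simp only [w]; positivity
  have hwk : w k * k ≤ 2 * (1 / k) := by
    simp only [w]
    calc 2 / ((k : ℝ) * (k + 1)) * k = 2 * (1 / (k + 1)) := by field_simp
      _ ≤ 2 * (1 / k) := by gcongr; linarith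
  have hge := (h.isSolution hz).toReal_le (hne k hk h1)
  rw [Real.norm_of_nonneg (sub_nonneg.2 hge), Real.norm_of_nonneg (by positivity),
    hval k hk h1, EReal.toReal_coe]
  have hsum : ∑ j ∈ Finset.range k, ((j : ℝ) + 1) *
        (F (x j) + (R (x j)).toReal + (H (y j)).toReal)
      - (∑ j ∈ Finset.range k, ((j : ℝ) + 1)) * (primalObj F R H K xs).toReal
      ≤ γ / 2 * (k * (2 * V 0) + k * S) + ‖us‖ * (k * (2 * B)) := by
    rw [Finset.sum_mul, ← Finset.sum_sub_distrib]
    have hterm : ∀ j ∈ Finset.range k, ((j : ℝ) + 1) *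
        (F (x j) + (R (x j)).toReal + (H (y j)).toReal)
        - ((j : ℝ) + 1) * (primalObj F R H K xs).toReal
        ≤ γ / 2 * (-(((j : ℝ) + 1) • (V (j + 1) - V j))
          + k * ‖gradient F (x j) - gradient F xs‖ ^ 2)
          + inner ℝ us (((j : ℝ) + 1) • (z (j + 1) - z j)) := by
      intro j hj
      have hjk : (j : ℝ) + 1 ≤ k := by exact_mod_cast Finset.mem_range.1 hj
      have g1 := h.value_sub_le hz j
      have g2 := h.monotoneGap_le hz j
      have hj0 : (0 : ℝ) ≤ (j : ℝ) + 1 := by positivity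
      have g3 := mul_le_mul_of_nonneg_left (g1.trans (add_le_add_left g2 _)) hj0
      -- Only the gradient term has its weight enlarged to k; the differences of V keep theirs for
      -- summation by parts.
      have g4 := mul_le_mul_of_nonneg_right hjk (sq_nonneg ‖gradient F (x j) - gradient F xs‖)
      have g5 := mul_le_mul_of_nonneg_left g4 (half_pos h.γ_pos).le
      rw [hyz] at g3
      rw [inner_smul_right, smul_eq_mul]
      linarith
    refine (Finset.sum_le_sum hterm).trans ?_
    rw [Finset.sum_add_distrib, ← Finset.mul_sum, Finset.sum_add_distrib, Finset.sum_neg_distrib,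
      ← inner_sum, ← Finset.mul_sum]
    have b1 := neg_le_of_abs_le (norm_sum_range_succ_smul_sub_le (z := V) (B := V 0) (fun j => by
      rw [Real.norm_of_nonneg (h.excess_nonneg _ _ _)]
      exact h.antitone_excess hz j.zero_le) k)
    have b2 := (real_inner_le_norm us _).trans (mul_le_mul_of_nonneg_left
      (norm_sum_range_succ_smul_sub_le hB k) (norm_nonneg us))
    have b3 : ∑ j ∈ Finset.range k, ‖gradient F (x j) - gradient F xs‖ ^ 2 ≤ S :=
      (h.summable hz).2.1.sum_le_tsum _ fun j _ => sq_nonneg _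
    have hγ := h.γ_pos
    gcongr
    linarith
  have hlip' := hlip _ h1 _ h2
  rw [norm_sub_rev, hyx, norm_smul, Real.norm_of_nonneg hw0] at hlip'
  have hlip2 := hlip'.trans (mul_le_mul_of_nonneg_left (mul_le_mul_of_nonneg_left
    (norm_sum_range_succ_smul_sub_le hB k) hw0) hM)
  have hsum' := mul_le_mul_of_nonneg_left hsum hw0
  have hw1 : w k * ∑ j ∈ Finset.range k, ((j : ℝ) + 1) = 1 := by
    rw [sum_range_natCast_succ]
    simp only [w]
    field_simp
  rw [mul_sub, ← mul_assoc, hw1, one_mul] at hsum'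
  have hB0 : 0 ≤ B := (norm_nonneg _).trans (hB 0)
  have hS0 : 0 ≤ S := tsum_nonneg fun k => sq_nonneg _
  have hV0 : 0 ≤ V 0 := h.excess_nonneg _ _ _
  have hγ := h.γ_pos
  have hfin := mul_le_mul_of_nonneg_right hwk
    (show 0 ≤ γ / 2 * (2 * V 0 + S) + ‖us‖ * (2 * B) + M * (2 * B) by positivity)
  have hJ := (hR k hk).2
  calc _ ≤ w k * (γ / 2 * (k * (2 * V 0) + k * S) + ‖us‖ * (k * (2 * B)))
        + M * (w k * (k * (2 * B))) := by linarith
    _ = w k * k * (γ / 2 * (2 * V 0 + S) + ‖us‖ * (2 * B) + M * (2 * B)) := by ring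
    _ ≤ _ := hfin
    _ = _ := by ring

end PD3OSequence

end Rates

/-! ### Index shifts and assembly of the theorem -/

theorem eventually_of_eventually_succ {P : ℕ → Prop} (h : ∀ᶠ k in atTop, P (k + 1)) :
    ∀ᶠ k in atTop, P k := by
  rw [← map_add_atTop_eq_nat 1]
  exact h

theorem isLittleO_one_div_sqrt_of_le {f a : ℕ → ℝ} {C : ℝ} (ha : Antitone a)
    (h0 : ∀ k, 0 ≤ a k) (hs : Summable a) (hf : ∀ᶠ k in atTop, |f (k + 1)| ≤ C * √(a k)) :
    f =o[atTop] fun k : ℕ => 1 / √(k : ℝ) := by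
  -- Truncated subtraction matches f at k + 1 with a at k; the value at 0 is irrelevant.
  have h1 : (fun k => a (k - 1)) =o[atTop] fun k : ℕ => 1 / (k : ℝ) :=
    isLittleO_one_div_of_antitone_of_summable (by simpa using ha) (by simpa using h0)
      (by simpa using hs)
  refine IsBigO.trans_isLittleO (IsBigO.of_bound C ?_) h1.sqrt_one_div
  refine eventually_of_eventually_succ (hf.mono fun k hk => ?_)
  rwa [Real.norm_eq_abs, Real.norm_of_nonneg (Real.sqrt_nonneg _), Nat.add_sub_cancel]

/-- The running minimum is nonincreasing and its excess over m is dominated by a summable sequence.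
The empty infimum at k = 0 plays no role. -/
theorem isLittleO_inf_toReal {f : ℕ → EReal} {m : ℝ} (hm : ∀ k, (m : EReal) ≤ f k)
    (htop : ∀ k ≥ 1, f k ≠ ⊤) (hs : Summable fun k => (f (k + 1)).toReal - m) :
    (fun k : ℕ => ((Finset.Icc 1 k).inf f).toReal - m) =o[atTop] fun k : ℕ => 1 / (k : ℝ) := by
  have hbot : ∀ k, (m : EReal) ≤ (Finset.Icc 1 k).inf f := fun k =>
    Finset.le_inf fun i _ => hm i
  have hle : ∀ k, (Finset.Icc 1 (k + 1)).inf f ≤ f (k + 1) := fun k =>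
    Finset.inf_le (Finset.mem_Icc.2 ⟨Nat.le_add_left 1 k, le_rfl⟩)
  have hne : ∀ k, (Finset.Icc 1 (k + 1)).inf f ≠ ⊤ := fun k =>
    ne_top_of_le_ne_top (htop (k + 1) (Nat.le_add_left 1 k)) (hle k)
  have hne' : ∀ k, (Finset.Icc 1 k).inf f ≠ ⊥ := fun k =>
    ne_bot_of_le_ne_bot (EReal.coe_ne_bot m) (hbot k)
  have h0 : ∀ k, 0 ≤ ((Finset.Icc 1 (k + 1)).inf f).toReal - m := fun k => by
    have := EReal.toReal_le_toReal (hbot (k + 1)) (EReal.coe_ne_bot m) (hne k)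
    rw [EReal.toReal_coe] at this
    linarith
  refine isLittleO_one_div_of_antitone_of_summable (antitone_nat_of_succ_le fun k => ?_) h0
    (hs.of_nonneg_of_le h0 fun k => ?_)
  · exact sub_le_sub_right (EReal.toReal_le_toReal
      (Finset.inf_mono (Finset.Icc_subset_Icc_right (Nat.le_succ _))) (hne' _) (hne k)) m
  · exact sub_le_sub_right (EReal.toReal_le_toReal (hle k) (hne' _)
      (htop (k + 1) (Nat.le_add_left 1 k))) m

theorem ergodicIterate_eq {X : Type*} [NormedAddCommGroup X] [InnerProductSpace ℝ X]
    (x : ℕ → X) (k : ℕ) : ergodicIterate x k = (2 / ((k : ℝ) * (k + 1))) •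
      ∑ j ∈ Finset.range k, ((j : ℝ) + 1) • x (j + 1) := by
  rw [ergodicIterate]
  congr 1
  induction k with
  | zero => simp
  | succ k ih =>
    rw [Finset.sum_Icc_succ_top (Nat.le_add_left 1 k), Finset.sum_range_succ, ih]
    push_cast
    rfl

theorem theorem1
    {X U : Type*}
    [NormedAddCommGroup X] [InnerProductSpace ℝ X] [CompleteSpace X] [FiniteDimensional ℝ X]
    [NormedAddCommGroup U] [InnerProductSpace ℝ U] [CompleteSpace U] [FiniteDimensional ℝ U]
    (F : X → ℝ) (R : X → EReal) (H : U → EReal) (K : X →L[ℝ] U)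
    (L_F : ℝ) (hL_F : 0 < L_F) (hFconv : ConvexOn ℝ Set.univ F) (hFsmooth : IsLSmooth L_F F)
    (hR : ProperClosedConvex R) (hH : ProperClosedConvex H)
    (hsol : ∃ x₀ : X, ∃ r ∈ subdiff R x₀, ∃ v ∈ subdiff H (K x₀),
      gradient F x₀ + r + ContinuousLinearMap.adjoint K v = 0)
    (γ η : ℝ) (hγ_pos : 0 < γ) (hγ_lt : γ < 2 / L_F) (hη_pos : 0 < η) (hη : ‖K‖ ^ 2 ≤ η)
    (x q : ℕ → X) (u : ℕ → U) (halg : IsPD3O F R H K (fun _ => γ) η x q u) :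
    ∃ (xs : X) (us : U),
      Tendsto x atTop (𝓝 xs) ∧ Tendsto u atTop (𝓝 us) ∧
      IsSolution (primalObj F R H K) xs ∧ IsSolution (dualObj F R H K) us ∧
      ((∃ ρ > 0, ContinuousOn H (Metric.ball (K xs) ρ)) →
        ((∀ᶠ k in atTop, primalObj F R H K (x k) ≠ ⊤) ∧
          (fun k : ℕ => (primalObj F R H K (x k)).toReal - (primalObj F R H K xs).toReal)
            =o[atTop] (fun k : ℕ => 1 / √(k : ℝ))) ∧
        ((∀ᶠ k in atTop, primalObj F R H K (ergodicIterate x k) ≠ ⊤) ∧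
          (fun k : ℕ => (primalObj F R H K (ergodicIterate x k)).toReal
              - (primalObj F R H K xs).toReal)
            =O[atTop] (fun k : ℕ => 1 / (k : ℝ)))) ∧
      (∀ (L : ℝ) (h : U → ℝ), 0 < L → IsLSmooth L h → (∀ v, H v = (h v : EReal)) →
        (∀ k ≥ 1, primalObj F R H K (x k) ≠ ⊤) ∧
        (fun k : ℕ => ((Finset.Icc 1 k).inf fun i => primalObj F R H K (x i)).toReal
            - (primalObj F R H K xs).toReal)
          =o[atTop] (fun k : ℕ => 1 / (k : ℝ))) := by
  obtain ⟨x₀, r, hr, v, hv, hsum⟩ := hsol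
  have hz : IsSaddlePoint F R H K x₀ v := by
    refine ⟨?_, hv⟩
    have e : r = -gradient F x₀ - ContinuousLinearMap.adjoint K v := by
      rw [eq_sub_iff_add_eq, eq_neg_iff_add_eq_zero, ← hsum]; abel
    rwa [← e]
  -- The primal sequence is shifted by one, since x at 0 is not constrained by the algorithm.
  have h : PD3OSequence F R H K L_F γ η (fun k => q k - ContinuousLinearMap.adjoint K (u k)) u
      (fun k => x (k + 1)) _ :=
    ⟨hL_F, hFconv, hFsmooth, hR, hH, hγ_pos, hγ_lt, hη_pos, hη,
      halg.pd3oStep hR hH hγ_pos hη_pos hv⟩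
  obtain ⟨xs, us, hs, hx, hu⟩ := h.exists_tendsto hz
  have hsolution := h.isSolution hs
  refine ⟨xs, us, (tendsto_add_atTop_iff_nat 1).1 hx, hu, hsolution,
    hs.isSolution_dualObj hR hH hFconv hFsmooth.differentiable, ?_, ?_⟩
  · rintro ⟨ρ, hρ, hcont⟩
    obtain ⟨hfin, C, hC⟩ := h.exists_abs_value_sub_le hs hx hu hρ hcont
    exact ⟨⟨eventually_of_eventually_succ hfin, isLittleO_one_div_sqrt_of_le
      h.antitone_increment h.increment_nonneg (h.summable hs).1 hC⟩,
      h.isBigO_ergodic_value hs hx hu hρ hcont (ergodicIterate_eq x)⟩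
  · intro L f hL hf hHf
    have htop : ∀ k ≥ 1, primalObj F R H K (x k) ≠ ⊤ := by
      intro k hk
      obtain ⟨j, rfl⟩ := Nat.exists_eq_add_of_le' hk
      rw [primalObj_eq_coe hR hH (h.R_ne_top j) (by rw [hHf]; exact EReal.coe_ne_top _)]
      exact EReal.coe_ne_top _
    obtain ⟨m, hm⟩ := hsolution.1
    have hsumm := h.summable_value_sub hL hf hHf hs
    refine ⟨htop, ?_⟩
    rw [hm, EReal.toReal_coe] at hsumm ⊢
    exact isLittleO_inf_toReal (fun k => hm ▸ hsolution.2 (x k)) htop hsumm
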